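/- Let $X$ be a random vector in $\mathbb{R}^p$ ($p\ge 1$) and $Y$ a real random variable with $E(Y^2)<\infty$, $E(\|X\|^2)<\infty$, $V(Y)>0$, $V(X)$ non-singular, and $E(Y\mid X)=\alpha_0+X'\beta_0$ for some $\alpha_0\in\mathbb{R}$, $\beta_0\in\mathbb{R}^p$. For a random variable $A$, let $A_0=A-E(A)$, let $F_A$ be its cdf, $\overline{F}_A=1-F_A$, and let $F^{-1}(t)=\inf\{x:F(x)\ge t\}$; let $\mathcal{S}$ be the unit sphere of $\mathbb{R}^p$ and set $U:=Y_0-X_0'\beta_0$. Let $$\mathcal{B}=\left\{\beta\in\mathbb{R}^p:\ \exists\ \text{r.v. } (\widetilde X,\widetilde Y):\ E(\widetilde Y_0\mid\widetilde X_0)=\widetilde X_0'\beta,\ \widetilde X\overset{d}{=}X,\ \widetilde Y\overset{d}{=}Y\right\}$$ and, for $\varepsilon\in(0,1/2)$, $$\mathcal{B}_\varepsilon=\left\{\lambda q:\ q\in\mathcal{S},\ 0\le\lambda\le S_\varepsilon(F_{Y_0},F_{X_0'q})\right\},\qquad S_\varepsilon(F,G)=\min_{\alpha\in[\varepsilon,1-\varepsilon]}\frac{\int_\alpha^1F^{-1}(t)\,dt}{\int_\alpha^1G^{-1}(t)\,dt}.$$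 Let $d_H$ denote the Hausdorff distance for the Euclidean norm. 1. Assume that $X$ has an elliptical distribution with a density with respect to the Lebesgue measure and that, for some $c>1$, $X_0'\beta_0$ has a density $f_{X_0'\beta_0}$ with $\liminf_{|x|\to\infty}|x|^{1+c}f_{X_0'\beta_0}(x)>0$. Suppose also that $\limsup_{x\to\infty}x^d\,\overline{F}_{|U|}(x)<\infty$ for some $d>c$. Then there exists $K_1>0$ such that, for all $\varepsilon>0$ small enough, $$d_H(\mathcal{B},\mathcal{B}_\varepsilon)\le K_1\,\varepsilon^{\frac{1/c-1/d}{1+1/d}}.$$ 2. Assume that $\beta_0=0$, that $\liminf_{x\to\infty}\inf_{q\in\mathcal{S}}x^c\,\overline{F}_{X_0'q}(x)>0$ for some real $c$, and that $\limsup_{x\to\infty}x^d\,\overline{F}_{|U|}(x)<\infty$ for some $d>c$. Then there exists $K_2>0$ such that, for all $\varepsilon>0$ small enough, $$d_H(\mathcal{B},\mathcal{B}_\varepsilon)\le K_2\,\varepsilon^{1/c-1/d}.$$ -/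

import Mathlib

open MeasureTheory ProbabilityTheory Filter Topology
open scoped ENNReal InnerProductSpace

noncomputable section

namespace DataCombination

/-- The centred random variable `A₀ = A - E(A)`. -/
def centered {Ω E : Type*} [MeasurableSpace Ω] [NormedAddCommGroup E] [NormedSpace ℝ E]
    (P : Measure Ω) (A : Ω → E) : Ω → E :=
  fun ω => A ω - ∫ ω', A ω' ∂P

/-- The linear index `X₀'q`, where `X₀ = X - E(X)`. -/
def centeredIndex {Ω : Type*} [MeasurableSpace Ω] {p : ℕ} (P : Measure Ω)
    (X : Ω → EuclideanSpace ℝ (Fin p)) (q : EuclideanSpace ℝ (Fin p)) : Ω → ℝ :=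
  fun ω => ⟪centered P X ω, q⟫_ℝ

/-- The cdf `F_A` of a real random variable `A`. -/
def cdfOf {Ω : Type*} [MeasurableSpace Ω] (P : Measure Ω) (A : Ω → ℝ) : ℝ → ℝ :=
  fun x => cdf (P.map A) x

/-- The survival function `1 - F_A(x) = P(A > x)`, as an extended nonnegative real. -/
def survival {Ω : Type*} [MeasurableSpace Ω] (P : Measure Ω) (A : Ω → ℝ) (x : ℝ) : ℝ≥0∞ :=
  P {ω | x < A ω}

/-- The generalized inverse `F⁻¹(t) = inf {x : F(x) ≥ t}`. -/
def quantile (F : ℝ → ℝ) (t : ℝ) : ℝ :=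
  sInf {x : ℝ | t ≤ F x}

/-- The ratio of superquantiles
`R(α, F, G) = (∫_α^1 F⁻¹(t) dt) / (∫_α^1 G⁻¹(t) dt)`. -/
def ratioR (α : ℝ) (F G : ℝ → ℝ) : ℝ :=
  (∫ t in α..1, quantile F t) / (∫ t in α..1, quantile G t)

/-- `S_ε(F, G)`, the minimum of `R(α, F, G)` over `α ∈ [ε, 1 - ε]`. -/
def regS (ε : ℝ) (F G : ℝ → ℝ) : ℝ :=
  sInf ((fun α => ratioR α F G) '' Set.Icc ε (1 - ε))

/-- The variance matrix `V(X)` of a random vector. -/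
def varianceMatrix {Ω : Type*} [MeasurableSpace Ω] {p : ℕ} (P : Measure Ω)
    (X : Ω → EuclideanSpace ℝ (Fin p)) : Matrix (Fin p) (Fin p) ℝ :=
  Matrix.of fun i j => covariance (fun ω => X ω i) (fun ω => X ω j) P

/-- The maintained assumption on `(X, Y)`: finite second moments, `V(Y) > 0`, `V(X)` non-singular
and `E(Y | X) = α₀ + X'β₀` for some `α₀`. -/
structure LinearModel {Ω : Type*} [MeasurableSpace Ω] {p : ℕ} (P : Measure Ω)
    (X : Ω → EuclideanSpace ℝ (Fin p)) (Y : Ω → ℝ) (β₀ : EuclideanSpace ℝ (Fin p)) : Prop where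
  measurable_X : Measurable X
  measurable_Y : Measurable Y
  sq_integrable_Y : MemLp Y 2 P
  sq_integrable_X : MemLp X 2 P
  variance_Y_pos : 0 < variance Y P
  variance_X_nonsingular : (varianceMatrix P X).det ≠ 0
  condExp_eq : ∃ α₀ : ℝ,
    P[Y | MeasurableSpace.comap X inferInstance] =ᵐ[P] fun ω => α₀ + ⟪X ω, β₀⟫_ℝ

/-- The identified set `B`: all `β` for which there are random variables `(X', Y')`, on some
probability space, with `X'` distributed as `X`, `Y'` distributed as `Y` and
`E(Y'₀ | X'₀) = X'₀'β`. -/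
def identifiedSet {Ω : Type*} [MeasurableSpace Ω] {p : ℕ} (P : Measure Ω)
    (X : Ω → EuclideanSpace ℝ (Fin p)) (Y : Ω → ℝ) : Set (EuclideanSpace ℝ (Fin p)) :=
  {β | ∃ (Ω' : Type) (_ : MeasurableSpace Ω') (P' : Measure Ω')
      (X' : Ω' → EuclideanSpace ℝ (Fin p)) (Y' : Ω' → ℝ),
      IsProbabilityMeasure P' ∧ Measurable X' ∧ Measurable Y' ∧
      IdentDistrib X' X P' P ∧ IdentDistrib Y' Y P' P ∧
      P'[centered P' Y' | MeasurableSpace.comap (centered P' X') inferInstance]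
        =ᵐ[P'] centeredIndex P' X' β}

/-- The regularized set `B_ε = {λ q : ‖q‖ = 1, 0 ≤ λ ≤ S_ε(F_{Y₀}, F_{X₀'q})}`. -/
def regularizedSet {Ω : Type*} [MeasurableSpace Ω] {p : ℕ} (P : Measure Ω)
    (X : Ω → EuclideanSpace ℝ (Fin p)) (Y : Ω → ℝ) (ε : ℝ) : Set (EuclideanSpace ℝ (Fin p)) :=
  {β | ∃ (q : EuclideanSpace ℝ (Fin p)) (l : ℝ), ‖q‖ = 1 ∧ 0 ≤ l ∧
      l ≤ regS ε (cdfOf P (centered P Y)) (cdfOf P (centeredIndex P X q)) ∧ β = l • q}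

/-- A probability law `ν` on `ℝ^p` is elliptical: for a location `m`, a positive semidefinite
scatter matrix `M` and a scalar function `ψ`, its characteristic function is
`t ↦ exp(i t'm) ψ(t'Mt)`. -/
def IsElliptical {p : ℕ} (ν : Measure (EuclideanSpace ℝ (Fin p))) : Prop :=
  ∃ (m : EuclideanSpace ℝ (Fin p)) (M : Matrix (Fin p) (Fin p) ℝ) (ψ : ℝ → ℂ),
    M.PosSemidef ∧ ∀ t : EuclideanSpace ℝ (Fin p),
      charFun ν t =
        Complex.exp ((⟪t, m⟫_ℝ : ℂ) * Complex.I) * ψ (t.ofLp ⬝ᵥ (M.mulVec t.ofLp))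

end DataCombination

end

/-! Write `SQ(A)` for `superquantile P A (1 - ε)`. By the Rockafellar–Uryasev formula, a
superquantile at level `α` is the minimum over `t` of `t (1 - α) + E (A - t)⁺`. Hence it is
subadditive, positively homogeneous, and monotone in the mean excess function.

If `β` lies in the identified set, conditional Jensen bounds the mean excess of `X₀'β` by that of
`Y₀`. So superquantiles are ordered at every level, and the identified set is contained in the
regularized one (`identifiedSet_subset_regularizedSet`). It remains to move each point `l q` of the
regularized set into the identified set at small cost.

In the elliptical case `X₀'q` has the law of `s X₀'β₀` for some `s > 0`. Drawing `Y` from its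
conditional law given the index puts `s⁻¹ q` in the identified set; mixing with the independent
coupling, which realizes `0`, yields the whole segment (`smul_mem_identifiedSet`). As `Y₀ = X₀'β₀ +
U`, subadditivity at level `1 - ε` gives `l ≤ s⁻¹ (1 + SQ(U) / SQ(X₀'β₀))`, so truncating `l` at
`s⁻¹` costs at most `s⁻¹ SQ(U) / SQ(X₀'β₀)`. The tail bounds make `SQ(U)` at most of order `ε^(1 -
1/d)` and `SQ(X₀'β₀)` at least of order `ε^(1 - 1/c)`, while `s⁻¹` is bounded over the sphere by
compactness. The resulting rate `ε^(1/c - 1/d)` is stronger than the one claimed in the elliptical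
case.

When `β₀ = 0`, one has `U = Y₀`, and the same ratio bounds the distance from `l q` to `0`. -/

noncomputable section

namespace DataCombination

/-! ### Generalized inverses and the Rockafellar–Uryasev formula. -/

section Quantile

variable {ρ : Measure ℝ}

/-- Right continuity of the cdf makes the infimum attained; the limits at `±∞` make the set nonempty
and bounded below for `u` inside `(0, 1)`. -/
theorem quantile_cdf_le_iff [IsProbabilityMeasure ρ] {u : ℝ} (hu : u ∈ Set.Ioo (0 : ℝ) 1) (x : ℝ) :
    quantile (cdf ρ) u ≤ x ↔ u ≤ cdf ρ x := by
  have hne : {x : ℝ | u ≤ cdf ρ x}.Nonempty :=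
    ((tendsto_cdf_atTop ρ).eventually (eventually_ge_nhds hu.2)).exists
  have hbdd : BddBelow {x : ℝ | u ≤ cdf ρ x} := by
    obtain ⟨b, hb⟩ := ((tendsto_cdf_atBot ρ).eventually (eventually_lt_nhds hu.1)).exists
    refine ⟨b, fun y hy => ?_⟩
    by_contra! h
    exact absurd (hy.trans (monotone_cdf ρ h.le)) (not_le.mpr hb)
  refine ⟨fun h => ?_, fun h => csInf_le hbdd h⟩
  have hgt : ∀ y, x < y → u ≤ cdf ρ y := fun y hy => by
    obtain ⟨z, hz, hzy⟩ := exists_lt_of_csInf_lt hne (lt_of_le_of_lt h hy)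
    exact le_trans hz (monotone_cdf ρ hzy.le)
  have hcont : Tendsto (cdf ρ) (𝓝[>] x) (𝓝 (cdf ρ x)) :=
    ((cdf ρ).right_continuous x).tendsto.mono_left (nhdsWithin_mono _ Set.Ioi_subset_Ici_self)
  exact ge_of_tendsto hcont (eventually_mem_nhdsWithin.mono fun y hy => hgt y hy)

theorem monotoneOn_quantile_cdf [IsProbabilityMeasure ρ] :
    MonotoneOn (quantile (cdf ρ)) (Set.Ioo 0 1) := fun _ hu _ hv huv =>
  (quantile_cdf_le_iff hu _).2 (huv.trans ((quantile_cdf_le_iff hv _).1 le_rfl))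

theorem aemeasurable_quantile_cdf [IsProbabilityMeasure ρ] :
    AEMeasurable (quantile (cdf ρ)) (volume.restrict (Set.Ioo 0 1)) :=
  aemeasurable_restrict_of_monotoneOn measurableSet_Ioo monotoneOn_quantile_cdf

theorem map_quantile_cdf [IsProbabilityMeasure ρ] :
    (volume.restrict (Set.Ioo (0 : ℝ) 1)).map (quantile (cdf ρ)) = ρ := by
  refine (Measure.ext_of_Iic ρ _ fun x => ?_).symm
  rw [Measure.map_apply_of_aemeasurable aemeasurable_quantile_cdf measurableSet_Iic,
    Measure.restrict_apply₀' measurableSet_Ioo.nullMeasurableSet, ← ofReal_cdf ρ x]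
  -- The preimage lies between the open and the closed interval from `0` to `F(x)`, both of length
  -- `F(x)`.
  have h1 : Set.Ioo 0 (cdf ρ x) ⊆ quantile (cdf ρ) ⁻¹' Set.Iic x ∩ Set.Ioo 0 1 := fun u hu =>
    have hu' : u ∈ Set.Ioo (0 : ℝ) 1 := ⟨hu.1, hu.2.trans_le (cdf_le_one ρ x)⟩
    ⟨(quantile_cdf_le_iff hu' x).2 hu.2.le, hu'⟩
  have h2 : quantile (cdf ρ) ⁻¹' Set.Iic x ∩ Set.Ioo 0 1 ⊆ Set.Icc 0 (cdf ρ x) := fun u hu =>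
    ⟨hu.2.1.le, (quantile_cdf_le_iff hu.2 x).1 hu.1⟩
  refine le_antisymm ?_ ?_
  · simpa using measure_mono (μ := volume) h1
  · simpa using measure_mono (μ := volume) h2

theorem integral_comp_quantile_cdf [IsProbabilityMeasure ρ] {φ : ℝ → ℝ} (hφ : Measurable φ) :
    ∫ u in Set.Ioo (0 : ℝ) 1, φ (quantile (cdf ρ) u) = ∫ x, φ x ∂ρ := by
  conv_rhs => rw [← map_quantile_cdf (ρ := ρ)]
  rw [integral_map aemeasurable_quantile_cdf hφ.aestronglyMeasurable]

theorem integrableOn_comp_quantile_cdf [IsProbabilityMeasure ρ] {φ : ℝ → ℝ} (hφ : Measurable φ)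
    (h : Integrable φ ρ) : IntegrableOn (fun u => φ (quantile (cdf ρ) u)) (Set.Ioo 0 1) := by
  rw [← map_quantile_cdf (ρ := ρ)] at h
  exact (integrable_map_measure hφ.aestronglyMeasurable aemeasurable_quantile_cdf).1 h

variable [IsProbabilityMeasure ρ] {α : ℝ}

theorem integral_quantile_sub_eq (t : ℝ) (h : Integrable (fun x => x) ρ)
    (hα : α ∈ Set.Ioo (0 : ℝ) 1) :
    ∫ u in Set.Ioo α 1, (quantile (cdf ρ) u - t) =
      (∫ u in α..1, quantile (cdf ρ) u) - t * (1 - α) := by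
  have hi : IntegrableOn (quantile (cdf ρ)) (Set.Ioo α 1) :=
    (integrableOn_comp_quantile_cdf measurable_id h).mono_set
      (Set.Ioo_subset_Ioo_left hα.1.le)
  rw [integral_sub hi (by simp), intervalIntegral.integral_of_le hα.2.le,
    integral_Ioc_eq_integral_Ioo]
  simp [hα.2.le, mul_comm]

/-- The superquantile is bounded by the Rockafellar–Uryasev objective at any threshold. -/
theorem integral_quantile_le (t : ℝ) (h : Integrable (fun x => x) ρ)
    (hα : α ∈ Set.Ioo (0 : ℝ) 1) :
    ∫ u in α..1, quantile (cdf ρ) u ≤ t * (1 - α) + ∫ x, max (x - t) 0 ∂ρ := by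
  have hpos : Integrable (fun x : ℝ => max (x - t) 0) ρ :=
    (h.sub (integrable_const t)).pos_part
  have hm : Measurable fun x : ℝ => max (x - t) 0 := by fun_prop
  have hi := integrableOn_comp_quantile_cdf hm hpos
  have hq : IntegrableOn (fun u => quantile (cdf ρ) u - t) (Set.Ioo α 1) :=
    (integrableOn_comp_quantile_cdf (φ := fun x => x - t) (by fun_prop)
      (h.sub (integrable_const t))).mono_set (Set.Ioo_subset_Ioo_left hα.1.le)
  have h1 := integral_quantile_sub_eq t h hα
  have h2 : ∫ u in Set.Ioo α 1, (quantile (cdf ρ) u - t) ≤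
      ∫ u in Set.Ioo α 1, max (quantile (cdf ρ) u - t) 0 :=
    setIntegral_mono hq (hi.mono_set (Set.Ioo_subset_Ioo_left hα.1.le)) fun u => le_max_left _ _
  have h3 : ∫ u in Set.Ioo α 1, max (quantile (cdf ρ) u - t) 0 ≤
      ∫ u in Set.Ioo 0 1, max (quantile (cdf ρ) u - t) 0 :=
    setIntegral_mono_set hi (ae_of_all _ fun u => le_max_right _ _)
      (Set.Ioo_subset_Ioo_left hα.1.le).eventuallyLE
  rw [integral_comp_quantile_cdf hm] at h3
  linarith

/-- The Rockafellar–Uryasev objective attains the superquantile at the quantile. -/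
theorem integral_quantile_eq (h : Integrable (fun x => x) ρ) (hα : α ∈ Set.Ioo (0 : ℝ) 1) :
    ∫ u in α..1, quantile (cdf ρ) u =
      quantile (cdf ρ) α * (1 - α) + ∫ x, max (x - quantile (cdf ρ) α) 0 ∂ρ := by
  set t := quantile (cdf ρ) α with ht
  have hm : Measurable fun x : ℝ => max (x - t) 0 := by fun_prop
  have h1 := integral_quantile_sub_eq t h hα
  -- By monotonicity the quantile is at least `t` to the right of `α` and at most `t` to its left,
  -- so the positive part keeps exactly the levels above `α`.
  have hsplit : ∫ u in Set.Ioo 0 1, max (quantile (cdf ρ) u - t) 0 =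
      ∫ u in Set.Ioo α 1, (quantile (cdf ρ) u - t) := by
    rw [← integral_indicator measurableSet_Ioo, ← integral_indicator measurableSet_Ioo]
    congr 1
    funext u
    by_cases hu : u ∈ Set.Ioo (0 : ℝ) 1
    · rw [Set.indicator_of_mem hu]
      by_cases hau : α < u
      · rw [Set.indicator_of_mem (show u ∈ Set.Ioo α 1 from ⟨hau, hu.2⟩), max_eq_left]
        exact sub_nonneg.2 (monotoneOn_quantile_cdf hα hu hau.le)
      · rw [Set.indicator_of_notMem (fun h => hau h.1), max_eq_right]
        exact sub_nonpos.2 (monotoneOn_quantile_cdf hu hα (not_lt.1 hau))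
    · rw [Set.indicator_of_notMem hu,
        Set.indicator_of_notMem (fun h => hu ⟨hα.1.trans h.1, h.2⟩)]
  rw [integral_comp_quantile_cdf hm] at hsplit
  linarith

end Quantile

/-- The unnormalized superquantile `∫_α^1 F_A⁻¹(t) dt`. -/
def superquantile {Ω : Type*} [MeasurableSpace Ω] (P : Measure Ω) (A : Ω → ℝ) (α : ℝ) : ℝ :=
  ∫ t in α..1, quantile (cdfOf P A) t

/-! ### Superquantiles of random variables and their tail estimates. -/

section Superquantile

variable {Ω : Type*} [MeasurableSpace Ω] {P : Measure Ω} {A B : Ω → ℝ} {α : ℝ}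

theorem integral_max_sub_map (hA : AEMeasurable A P) (t : ℝ) :
    ∫ x, max (x - t) 0 ∂(P.map A) = ∫ ω, max (A ω - t) 0 ∂P :=
  integral_map hA (by fun_prop)

theorem superquantile_congr {Ω' : Type*} [MeasurableSpace Ω'] {P' : Measure Ω'}
    {B : Ω' → ℝ} (h : P.map A = P'.map B) (α : ℝ) :
    superquantile P A α = superquantile P' B α := by
  unfold superquantile cdfOf
  rw [h]

variable [IsProbabilityMeasure P]

theorem integrable_max_sub (hA : Integrable A P) (t : ℝ) :
    Integrable (fun ω => max (A ω - t) 0) P :=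
  (hA.sub (integrable_const t)).pos_part

theorem superquantile_le (hA : Integrable A P) (hα : α ∈ Set.Ioo (0 : ℝ) 1) (t : ℝ) :
    superquantile P A α ≤ t * (1 - α) + ∫ ω, max (A ω - t) 0 ∂P := by
  have := Measure.isProbabilityMeasure_map (μ := P) hA.aemeasurable
  rw [← integral_max_sub_map hA.aemeasurable]
  exact integral_quantile_le t
    ((integrable_map_measure aestronglyMeasurable_id hA.aemeasurable).2 hA) hα

theorem superquantile_eq (hA : Integrable A P) (hα : α ∈ Set.Ioo (0 : ℝ) 1) :
    superquantile P A α = quantile (cdfOf P A) α * (1 - α) +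
      ∫ ω, max (A ω - quantile (cdfOf P A) α) 0 ∂P := by
  have := Measure.isProbabilityMeasure_map (μ := P) hA.aemeasurable
  rw [← integral_max_sub_map hA.aemeasurable]
  exact integral_quantile_eq
    ((integrable_map_measure aestronglyMeasurable_id hA.aemeasurable).2 hA) hα

/-- The sum of the two optimal thresholds is an admissible threshold for `A + B`, and the positive
part is subadditive. -/
theorem superquantile_add_le (hA : Integrable A P) (hB : Integrable B P)
    (hα : α ∈ Set.Ioo (0 : ℝ) 1) :
    superquantile P (fun ω => A ω + B ω) α ≤ superquantile P A α + superquantile P B α := by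
  set s := quantile (cdfOf P A) α
  set t := quantile (cdfOf P B) α
  have h1 := superquantile_le (hA.add hB) hα (s + t)
  have h2 : ∫ ω, max ((A + B) ω - (s + t)) 0 ∂P ≤
      ∫ ω, (max (A ω - s) 0 + max (B ω - t) 0) ∂P := by
    refine integral_mono (integrable_max_sub (hA.add hB) _)
      ((integrable_max_sub hA s).add (integrable_max_sub hB t)) fun ω => ?_
    simp only [Pi.add_apply]
    refine max_le ?_ (by positivity)
    linarith [le_max_left (A ω - s) 0, le_max_left (B ω - t) 0]
  rw [integral_add (integrable_max_sub hA s) (integrable_max_sub hB t)] at h2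
  rw [superquantile_eq hA hα, superquantile_eq hB hα]
  change superquantile P (A + B) α ≤ _
  linarith

/-- The threshold that is optimal for `B` is admissible for `A`. -/
theorem superquantile_mono {Ω' : Type*} [MeasurableSpace Ω'] {P' : Measure Ω'}
    [IsProbabilityMeasure P'] {B : Ω' → ℝ} (hA : Integrable A P) (hB : Integrable B P')
    (hα : α ∈ Set.Ioo (0 : ℝ) 1)
    (h : ∀ t, ∫ ω, max (A ω - t) 0 ∂P ≤ ∫ ω, max (B ω - t) 0 ∂P') :
    superquantile P A α ≤ superquantile P' B α := by
  rw [superquantile_eq hB hα]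
  exact (superquantile_le hA hα _).trans (by gcongr; exact h _)

/-- Testing `A` at the threshold `t / l`, with `t` optimal for `l A`, gives one inequality. Applying
it with `l⁻¹` gives the reverse in `superquantile_const_mul`. -/
theorem mul_superquantile_le (hA : Integrable A P) (hα : α ∈ Set.Ioo (0 : ℝ) 1) {l : ℝ}
    (hl : 0 < l) : l * superquantile P A α ≤ superquantile P (fun ω => l * A ω) α := by
  rw [superquantile_eq (hA.const_mul l) hα]
  set t := quantile (cdfOf P fun ω => l * A ω) α
  have h := mul_le_mul_of_nonneg_left (superquantile_le hA hα (t / l)) hl.le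
  have e : ∫ ω, max (l * A ω - t) 0 ∂P = l * ∫ ω, max (A ω - t / l) 0 ∂P := by
    rw [← integral_const_mul]
    congr 1 with ω
    rw [mul_max_of_nonneg _ _ hl.le, mul_sub, mul_div_cancel₀ _ hl.ne', mul_zero]
  rw [e]
  calc _ ≤ _ := h
    _ = _ := by field_simp

theorem superquantile_const_mul (hA : Integrable A P) (hα : α ∈ Set.Ioo (0 : ℝ) 1) {l : ℝ}
    (hl : 0 < l) : superquantile P (fun ω => l * A ω) α = l * superquantile P A α := by
  refine le_antisymm ?_ (mul_superquantile_le hA hα hl)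
  have h := mul_superquantile_le (hA.const_mul l) hα (inv_pos.2 hl)
  simp only [inv_mul_cancel_left₀ hl.ne'] at h
  rwa [inv_mul_le_iff₀ hl] at h

theorem superquantile_nonneg (hA : Integrable A P) (h0 : ∫ ω, A ω ∂P = 0)
    (hα : α ∈ Set.Ioo (0 : ℝ) 1) : 0 ≤ superquantile P A α := by
  rw [superquantile_eq hA hα]
  set t := quantile (cdfOf P A) α
  have h1 : 0 ≤ ∫ ω, max (A ω - t) 0 ∂P := integral_nonneg fun ω => le_max_right _ _
  have h2 : ∫ ω, (A ω - t) ∂P ≤ ∫ ω, max (A ω - t) 0 ∂P :=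
    integral_mono (hA.sub (integrable_const t)) (integrable_max_sub hA t)
      fun ω => le_max_left _ _
  rw [integral_sub hA (integrable_const t), h0] at h2
  simp at h2
  obtain ⟨ha, hb⟩ := hα
  rcases le_total 0 t with ht | ht
  · have := mul_nonneg ht (sub_nonneg.2 hb.le)
    linarith
  · nlinarith

theorem superquantile_pos (hA : Integrable A P) (h0 : ∫ ω, A ω ∂P = 0) (hne : ¬ A =ᵐ[P] 0)
    (hα : α ∈ Set.Ioo (0 : ℝ) 1) : 0 < superquantile P A α := by
  rw [superquantile_eq hA hα]
  set t := quantile (cdfOf P A) α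
  have h1 : 0 ≤ ∫ ω, max (A ω - t) 0 ∂P := integral_nonneg fun ω => le_max_right _ _
  have h2 : ∫ ω, (A ω - t) ∂P ≤ ∫ ω, max (A ω - t) 0 ∂P :=
    integral_mono (hA.sub (integrable_const t)) (integrable_max_sub hA t)
      fun ω => le_max_left _ _
  rw [integral_sub hA (integrable_const t), h0] at h2
  simp at h2
  obtain ⟨ha, hb⟩ := hα
  -- For `t < 0`, zero mean bounds the mean excess below by `-t`, leaving at least `-t α > 0`. Only
  -- `t = 0` uses non-degeneracy: a zero positive part and a zero mean force `A = 0` almost surely.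
  rcases lt_trichotomy 0 t with ht | ht | ht
  · have := mul_pos ht (sub_pos.2 hb)
    linarith
  · rw [← ht] at h1 ⊢
    simp only [zero_mul, zero_add, sub_zero] at h1 ⊢
    refine lt_of_le_of_ne h1 fun he => hne ?_
    have hz : (fun ω => max (A ω) 0) =ᵐ[P] 0 :=
      (integral_eq_zero_iff_of_nonneg (fun ω => le_max_right _ _) hA.pos_part).1 he.symm
    have hz' : 0 ≤ᵐ[P] fun ω => - A ω := by
      filter_upwards [hz] with ω hω
      have := le_max_left (A ω) 0
      simp only [Pi.zero_apply] at hω ⊢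
      linarith
    have := (integral_eq_zero_iff_of_nonneg_ae hz' hA.neg).1 (by simp [integral_neg, h0])
    filter_upwards [this] with ω hω
    simpa using hω
  · nlinarith

/-- A lower bound on the superquantile from a lower bound on the tail. -/
theorem mul_le_superquantile_of_lt_survival (hA : Integrable A P) {ε x : ℝ}
    (hε : ε ∈ Set.Ioo (0 : ℝ) 1) (h : ENNReal.ofReal ε < survival P A x) :
    x * ε ≤ superquantile P A (1 - ε) := by
  have hprob := Measure.isProbabilityMeasure_map (μ := P) hA.aemeasurable
  have hα : 1 - ε ∈ Set.Ioo (0 : ℝ) 1 := ⟨by linarith [hε.2], by linarith [hε.1]⟩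
  have hx : x ≤ quantile (cdfOf P A) (1 - ε) := by
    by_contra! hlt
    have h1 := (quantile_cdf_le_iff (ρ := P.map A) hα x).1 hlt.le
    have h2 : survival P A x = P.map A (Set.Iic x)ᶜ := by
      rw [Measure.map_apply_of_aemeasurable hA.aemeasurable measurableSet_Iic.compl]
      simp [survival, Set.preimage, Set.compl_Iic]
    rw [h2, prob_compl_eq_one_sub measurableSet_Iic, ← ofReal_cdf, ← ENNReal.ofReal_one,
      ← ENNReal.ofReal_sub _ (cdf_nonneg _ _)] at h
    have := (ENNReal.ofReal_le_ofReal (show 1 - cdf (P.map A) x ≤ ε by linarith))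
    exact absurd h (not_lt.2 this)
  have h1 : 0 ≤ ∫ ω, max (A ω - quantile (cdfOf P A) (1 - ε)) 0 ∂P :=
    integral_nonneg fun ω => le_max_right _ _
  rw [superquantile_eq hA hα]
  have := mul_le_mul_of_nonneg_right hx hε.1.le
  have e : (1 - (1 - ε)) = ε := by ring
  rw [e]
  linarith

/-- The mean excess of a variable with a polynomially decaying tail. -/
theorem integral_max_sub_le_of_survival_le (hA : Integrable A P) {C d x₀ t : ℝ} (hd : 1 < d)
    (ht0 : 0 < t) (ht : x₀ ≤ t)
    (h : ∀ x, x₀ ≤ x → survival P (fun ω => |A ω|) x ≤ ENNReal.ofReal (C * x ^ (-d))) (hC : 0 ≤ C) :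
    ∫ ω, max (A ω - t) 0 ∂P ≤ C * (t ^ (1 - d) / (d - 1)) := by
  -- Layer-cake formula: the mean excess is the integral of the survival function beyond `t`.
  rw [Integrable.integral_eq_integral_meas_lt (integrable_max_sub hA t)
    (ae_of_all _ fun ω => le_max_right _ _)]
  have hint : IntegrableOn (fun x : ℝ => C * x ^ (-d)) (Set.Ioi t) :=
    (integrableOn_Ioi_rpow_of_lt (by linarith) ht0).const_mul C
  have hval : ∫ x in Set.Ioi t, C * x ^ (-d) = C * (t ^ (1 - d) / (d - 1)) := by
    rw [integral_const_mul, integral_Ioi_rpow_of_lt (by linarith) ht0,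
      show -d + 1 = -(d - 1) by ring, neg_div_neg_eq, show -(d - 1) = 1 - d by ring]
  rw [← hval]
  have hpre : (fun x : ℝ => x + t) ⁻¹' Set.Ioi t = Set.Ioi 0 := by
    ext x; simp
  have hshift : ∫ x in Set.Ioi (0 : ℝ), C * (x + t) ^ (-d) = ∫ x in Set.Ioi t, C * x ^ (-d) := by
    have := (measurePreserving_add_right volume t).setIntegral_preimage_emb
      (measurableEmbedding_addRight t) (fun x : ℝ => C * x ^ (-d)) (Set.Ioi t)
    rwa [hpre] at this
  have hint' : IntegrableOn (fun x : ℝ => C * (x + t) ^ (-d)) (Set.Ioi 0) := by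
    have := ((measurePreserving_add_right volume t).integrableOn_comp_preimage
      (measurableEmbedding_addRight t)).2 hint
    rwa [hpre] at this
  rw [← hshift]
  refine integral_mono_of_nonneg (ae_of_all _ fun x => measureReal_nonneg) hint' ?_
  refine (ae_restrict_iff' measurableSet_Ioi).2 (ae_of_all _ fun x hx => ?_)
  have hx0 : (0 : ℝ) < x := hx
  have hle : P {ω | x < max (A ω - t) 0} ≤ ENNReal.ofReal (C * (x + t) ^ (-d)) := by
    refine (measure_mono fun ω hω => ?_).trans (h (x + t) (by linarith))
    rcases lt_max_iff.1 (show x < max (A ω - t) 0 from hω) with h' | h'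
    · exact (show x + t < A ω by linarith).trans_le (le_abs_self _)
    · exact absurd h' (not_lt.2 hx0.le)
  exact ENNReal.toReal_le_of_le_ofReal (by positivity) hle

end Superquantile

/-! ### The identified set described by couplings of `X` and `Y`. -/

section Coupling

variable {Ω : Type*} [MeasurableSpace Ω] {P : Measure Ω} {p : ℕ}
  {X : Ω → EuclideanSpace ℝ (Fin p)} {Y : Ω → ℝ}

theorem measurable_centered {E : Type*} [NormedAddCommGroup E] [NormedSpace ℝ E]
    [MeasurableSpace E] [BorelSpace E] [SecondCountableTopology E] {A : Ω → E}
    (hA : Measurable A) : Measurable (centered P A) :=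
  hA.sub_const _

theorem measurable_centeredIndex (hX : Measurable X) (q : EuclideanSpace ℝ (Fin p)) :
    Measurable (centeredIndex P X q) :=
  (measurable_centered hX).inner_const

theorem centeredIndex_smul (l : ℝ) (q : EuclideanSpace ℝ (Fin p)) :
    centeredIndex P X (l • q) = fun ω => l * centeredIndex P X q ω := by
  funext ω
  simp [centeredIndex, real_inner_smul_right]

theorem centeredIndex_zero : centeredIndex P X 0 = fun _ => (0 : ℝ) := by
  funext ω
  simp [centeredIndex]

variable [IsProbabilityMeasure P]

theorem integrable_centered {E : Type*} [NormedAddCommGroup E] [NormedSpace ℝ E]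
    {A : Ω → E} (hA : Integrable A P) : Integrable (centered P A) P :=
  hA.sub (integrable_const _)

theorem integral_centered {E : Type*} [NormedAddCommGroup E] [NormedSpace ℝ E] [CompleteSpace E]
    {A : Ω → E} (hA : Integrable A P) : ∫ ω, centered P A ω ∂P = 0 := by
  simp only [centered]
  rw [integral_sub hA (integrable_const _)]
  simp

theorem integrable_centeredIndex (hX : Integrable X P) (q : EuclideanSpace ℝ (Fin p)) :
    Integrable (centeredIndex P X q) P :=
  (integrable_centered hX).inner_const q

theorem integral_centeredIndex (hX : Integrable X P) (q : EuclideanSpace ℝ (Fin p)) :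
    ∫ ω, centeredIndex P X q ω ∂P = 0 := by
  have := integral_inner (𝕜 := ℝ) (integrable_centered hX) q
  rw [integral_centered hX, inner_zero_right] at this
  rw [← this]
  exact integral_congr_ae (ae_of_all _ fun ω => real_inner_comm _ _)

omit [IsProbabilityMeasure P] in
/-- Conditional Jensen inequality for the elements of the identified set. -/
theorem integral_max_sub_le_of_mem_identifiedSet (hX : Integrable X P) (hY : Integrable Y P)
    {β : EuclideanSpace ℝ (Fin p)} (hβ : β ∈ identifiedSet P X Y) (t : ℝ) :
    ∫ ω, max (centeredIndex P X β ω - t) 0 ∂P ≤ ∫ ω, max (centered P Y ω - t) 0 ∂P := by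
  obtain ⟨Ω', _, P', X', Y', _, hX'm, hY'm, hXX, hYY, hc⟩ := hβ
  have hY' : Integrable Y' P' := hYY.symm.integrable_snd hY
  have hEX : ∫ ω, X' ω ∂P' = ∫ ω, X ω ∂P := hXX.integral_eq
  have hEY : ∫ ω, Y' ω ∂P' = ∫ ω, Y ω ∂P := hYY.integral_eq
  have e1 : ∫ ω, max (centeredIndex P X β ω - t) 0 ∂P =
      ∫ ω, max (centeredIndex P' X' β ω - t) 0 ∂P' := by
    have := (hXX.comp (u := fun x => max (⟪x - ∫ ω, X ω ∂P, β⟫_ℝ - t) 0)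
      (by fun_prop)).integral_eq
    simp only [centeredIndex, centered, hEX]
    exact this.symm
  have e2 : ∫ ω, max (centered P Y ω - t) 0 ∂P = ∫ ω, max (centered P' Y' ω - t) 0 ∂P' := by
    have := (hYY.comp (u := fun x => max ((x - ∫ ω, Y ω ∂P) - t) 0) (by fun_prop)).integral_eq
    simp only [centered, hEY]
    exact this.symm
  rw [e1, e2]
  have hm := (measurable_centered (P := P') hX'm).comap_le
  have hconv : ConvexOn ℝ Set.univ fun x : ℝ => max (x - t) 0 :=
    ((convexOn_id convex_univ).add_const (-t)).sup (convexOn_const 0 convex_univ)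
  have hint := integrable_centered hY'
  have hint2 : Integrable ((fun x : ℝ => max (x - t) 0) ∘ centered P' Y') P' :=
    integrable_max_sub hint t
  -- Jensen for the convex map `x ↦ (x - t)⁺`, conditionally on `X'₀`, under which the mean of `Y'₀`
  -- is the index.
  have hJ := hconv.map_condExp_le_univ hm
    (Continuous.lowerSemicontinuous (by fun_prop)) hint hint2
  rw [← integral_condExp hm (f := fun ω => max (centered P' Y' ω - t) 0)]
  refine integral_mono_ae
    (integrable_max_sub (integrable_centeredIndex (hXX.symm.integrable_snd hX) β) t)
    integrable_condExp ?_
  filter_upwards [hJ, hc] with ω h1 h2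
  simp only [Function.comp_apply] at h1
  rw [h2] at h1
  exact h1

/-- A joint law with the marginals of `X` and `Y` under which the mean of `Y₀` given `X` is
`X₀'β`. -/
structure IsMeanCoupling (P : Measure Ω) (X : Ω → EuclideanSpace ℝ (Fin p)) (Y : Ω → ℝ)
    (β : EuclideanSpace ℝ (Fin p)) (γ : Measure (EuclideanSpace ℝ (Fin p) × ℝ)) : Prop where
  map_fst : γ.map Prod.fst = P.map X
  map_snd : γ.map Prod.snd = P.map Y
  setIntegral_eq : ∀ A : Set (EuclideanSpace ℝ (Fin p)), MeasurableSet A →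
    ∫ z in Prod.fst ⁻¹' A, (z.2 - ∫ ω, Y ω ∂P) ∂γ =
      ∫ z in Prod.fst ⁻¹' A, ⟪z.1 - ∫ ω, X ω ∂P, β⟫_ℝ ∂γ

omit [IsProbabilityMeasure P] in
theorem IsMeanCoupling.identDistrib_fst (hX : Measurable X) {β : EuclideanSpace ℝ (Fin p)}
    {γ : Measure (EuclideanSpace ℝ (Fin p) × ℝ)} (h : IsMeanCoupling P X Y β γ) :
    IdentDistrib Prod.fst X γ P := ⟨by fun_prop, hX.aemeasurable, h.map_fst⟩

omit [IsProbabilityMeasure P] in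
theorem IsMeanCoupling.identDistrib_snd (hY : Measurable Y) {β : EuclideanSpace ℝ (Fin p)}
    {γ : Measure (EuclideanSpace ℝ (Fin p) × ℝ)} (h : IsMeanCoupling P X Y β γ) :
    IdentDistrib Prod.snd Y γ P := ⟨by fun_prop, hY.aemeasurable, h.map_snd⟩

/-- The coordinates under `γ` serve as the pair required: the set-integral identity characterizes
the conditional expectation, and events of `X₀` are events of `X` after a translation. -/
theorem IsMeanCoupling.mem_identifiedSet (hXm : Measurable X) (hYm : Measurable Y)
    (hX : Integrable X P) (hY : Integrable Y P)
    {β : EuclideanSpace ℝ (Fin p)} {γ : Measure (EuclideanSpace ℝ (Fin p) × ℝ)}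
    (h : IsMeanCoupling P X Y β γ) : β ∈ identifiedSet P X Y := by
  have hX1 := h.identDistrib_fst hXm
  have hY1 := h.identDistrib_snd hYm
  have hγ : IsProbabilityMeasure γ := by
    have : IsProbabilityMeasure (γ.map Prod.fst) := by
      rw [h.map_fst]; exact Measure.isProbabilityMeasure_map hXm.aemeasurable
    exact Measure.isProbabilityMeasure_of_map Prod.fst
  refine ⟨_, _, γ, Prod.fst, Prod.snd, hγ, measurable_fst, measurable_snd, hX1, hY1, ?_⟩
  have hEX := hX1.integral_eq
  have hEY := hY1.integral_eq
  have hm := (measurable_centered (P := γ)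
    (measurable_fst (α := EuclideanSpace ℝ (Fin p)) (β := ℝ))).comap_le
  have hXγ : Integrable Prod.fst γ := hX1.symm.integrable_snd hX
  have hYγ : Integrable Prod.snd γ := hY1.symm.integrable_snd hY
  refine (ae_eq_condExp_of_forall_setIntegral_eq hm (integrable_centered hYγ)
    (fun s _ _ => (integrable_centeredIndex hXγ β).integrableOn) ?_ ?_).symm
  · rintro s ⟨B, hB, rfl⟩ _
    have := h.setIntegral_eq ((fun x => x - ∫ ω, X ω ∂P) ⁻¹' B)
      ((measurable_id.sub_const _) hB)
    have hpre : centered γ Prod.fst ⁻¹' B =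
        Prod.fst ⁻¹' ((fun x => x - ∫ ω, X ω ∂P) ⁻¹' B) := by
      ext z
      simp [centered, hEX]
    rw [hpre]
    simp only [centeredIndex, centered, hEX, hEY]
    exact this.symm
  · refine Measurable.aestronglyMeasurable ?_
    have h1 : Measurable fun x : EuclideanSpace ℝ (Fin p) => ⟪x, β⟫_ℝ := by fun_prop
    exact h1.comp (comap_measurable _)

/-- The integral of an index over an event of `X` depends only on the first marginal, which both
couplings share. The mean condition is therefore linear in `(β, γ)`. -/
theorem IsMeanCoupling.convexCombination (hXm : Measurable X) (hYm : Measurable Y)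
    (hX : Integrable X P) (hY : Integrable Y P)
    {β₁ β₂ : EuclideanSpace ℝ (Fin p)} {γ₁ γ₂ : Measure (EuclideanSpace ℝ (Fin p) × ℝ)}
    (h₁ : IsMeanCoupling P X Y β₁ γ₁) (h₂ : IsMeanCoupling P X Y β₂ γ₂) {a b : NNReal}
    (hab : a + b = 1) :
    IsMeanCoupling P X Y ((a : ℝ) • β₁ + (b : ℝ) • β₂) (a • γ₁ + b • γ₂) := by
  have hcomb (ρ : Measure ℝ) : a • ρ + b • ρ = ρ := by rw [← add_smul, hab, one_smul]
  have hX1 := h₁.identDistrib_fst hXm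
  have hX2 := h₂.identDistrib_fst hXm
  have hY1 : Integrable Prod.snd γ₁ := (h₁.identDistrib_snd hYm).symm.integrable_snd hY
  have hY2 : Integrable Prod.snd γ₂ := (h₂.identDistrib_snd hYm).symm.integrable_snd hY
  have hI1 : Integrable Prod.fst γ₁ := hX1.symm.integrable_snd hX
  have hI2 : Integrable Prod.fst γ₂ := hX2.symm.integrable_snd hX
  have hf1 : IsFiniteMeasure γ₁ := by
    have : IsFiniteMeasure (γ₁.map Prod.fst) := by rw [h₁.map_fst]; infer_instance
    exact Measure.isFiniteMeasure_of_map (f := Prod.fst) (by fun_prop)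
  have hf2 : IsFiniteMeasure γ₂ := by
    have : IsFiniteMeasure (γ₂.map Prod.fst) := by rw [h₂.map_fst]; infer_instance
    exact Measure.isFiniteMeasure_of_map (f := Prod.fst) (by fun_prop)
  have hind (β : EuclideanSpace ℝ (Fin p)) :
      Integrable (fun z : EuclideanSpace ℝ (Fin p) × ℝ => ⟪z.1 - ∫ ω, X ω ∂P, β⟫_ℝ) γ₁ ∧
      Integrable (fun z : EuclideanSpace ℝ (Fin p) × ℝ => ⟪z.1 - ∫ ω, X ω ∂P, β⟫_ℝ) γ₂ :=
    ⟨(hI1.sub (integrable_const _)).inner_const β, (hI2.sub (integrable_const _)).inner_const β⟩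
  have hres (A : Set (EuclideanSpace ℝ (Fin p))) {f : EuclideanSpace ℝ (Fin p) × ℝ → ℝ}
      (hf1 : Integrable f γ₁) (hf2 : Integrable f γ₂) :
      ∫ z in Prod.fst ⁻¹' A, f z ∂(a • γ₁ + b • γ₂) =
        (a : ℝ) * ∫ z in Prod.fst ⁻¹' A, f z ∂γ₁ + b * ∫ z in Prod.fst ⁻¹' A, f z ∂γ₂ := by
    rw [Measure.restrict_add, Measure.restrict_smul, Measure.restrict_smul,
      integral_add_measure (hf1.integrableOn.smul_measure_nnreal)
        (hf2.integrableOn.smul_measure_nnreal), integral_smul_nnreal_measure,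
      integral_smul_nnreal_measure]
    rfl
  have hswap {A : Set (EuclideanSpace ℝ (Fin p))} (hA : MeasurableSet A)
      (β : EuclideanSpace ℝ (Fin p)) :
      ∫ z in Prod.fst ⁻¹' A, ⟪z.1 - ∫ ω, X ω ∂P, β⟫_ℝ ∂γ₁ =
        ∫ z in Prod.fst ⁻¹' A, ⟪z.1 - ∫ ω, X ω ∂P, β⟫_ℝ ∂γ₂ := by
    have hm : Measurable fun x : EuclideanSpace ℝ (Fin p) => ⟪x - ∫ ω, X ω ∂P, β⟫_ℝ := by fun_prop
    have e (γ : Measure (EuclideanSpace ℝ (Fin p) × ℝ)) :=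
      setIntegral_map (μ := γ) hA hm.aestronglyMeasurable measurable_fst.aemeasurable
    rw [← e γ₁, ← e γ₂, h₁.map_fst, h₂.map_fst]
  refine ⟨?_, ?_, fun A hA => ?_⟩
  · rw [Measure.map_add _ _ measurable_fst, Measure.map_smul, Measure.map_smul, h₁.map_fst,
      h₂.map_fst, ← add_smul, hab, one_smul]
  · rw [Measure.map_add _ _ measurable_snd, Measure.map_smul, Measure.map_smul, h₁.map_snd,
      h₂.map_snd, hcomb]
  · have hY1' : Integrable (fun z : EuclideanSpace ℝ (Fin p) × ℝ => z.2 - ∫ ω, Y ω ∂P) γ₁ :=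
      hY1.sub (integrable_const _)
    have hY2' : Integrable (fun z : EuclideanSpace ℝ (Fin p) × ℝ => z.2 - ∫ ω, Y ω ∂P) γ₂ :=
      hY2.sub (integrable_const _)
    rw [hres A hY1' hY2',
      hres A (hind _).1 (hind _).2, h₁.setIntegral_eq A hA, h₂.setIntegral_eq A hA]
    have hlin (γ : Measure (EuclideanSpace ℝ (Fin p) × ℝ))
        (hi : ∀ β, Integrable
          (fun z : EuclideanSpace ℝ (Fin p) × ℝ => ⟪z.1 - ∫ ω, X ω ∂P, β⟫_ℝ) γ) :
        ∫ z in Prod.fst ⁻¹' A, ⟪z.1 - ∫ ω, X ω ∂P, (a : ℝ) • β₁ + (b : ℝ) • β₂⟫_ℝ ∂γ =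
        (a : ℝ) * ∫ z in Prod.fst ⁻¹' A, ⟪z.1 - ∫ ω, X ω ∂P, β₁⟫_ℝ ∂γ +
        (b : ℝ) * ∫ z in Prod.fst ⁻¹' A, ⟪z.1 - ∫ ω, X ω ∂P, β₂⟫_ℝ ∂γ := by
      simp only [inner_add_right, real_inner_smul_right]
      rw [integral_add ((hi β₁).integrableOn.const_mul _) ((hi β₂).integrableOn.const_mul _),
        integral_const_mul, integral_const_mul]
    rw [hlin γ₁ fun β => (hind β).1, hlin γ₂ fun β => (hind β).2, hswap hA β₁, hswap hA β₂]
    have hab' : (a : ℝ) + b = 1 := by exact_mod_cast hab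
    linear_combination (-1 : ℝ) * (a * ∫ z in Prod.fst ⁻¹' A, ⟪z.1 - ∫ ω, X ω ∂P, β₁⟫_ℝ ∂γ₂ +
      b * ∫ z in Prod.fst ⁻¹' A, ⟪z.1 - ∫ ω, X ω ∂P, β₂⟫_ℝ ∂γ₂) * hab'

/-- If `X₀'β` has the law of a variable `A` with `E(Y₀ | A) = A`, drawing `Y` from its conditional
law given `A = X₀'β` couples `X` and `Y`. -/
theorem exists_isMeanCoupling_of_condExp (hXm : Measurable X) (hYm : Measurable Y)
    (hX : Integrable X P) (hY : Integrable Y P) {β : EuclideanSpace ℝ (Fin p)}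
    {A : Ω → ℝ} (hA : Measurable A) (hlaw : P.map (centeredIndex P X β) = P.map A)
    (hc : P[Y | MeasurableSpace.comap A inferInstance] =ᵐ[P] fun ω => A ω + ∫ ω', Y ω' ∂P) :
    ∃ γ, IsMeanCoupling P X Y β γ := by
  set g : EuclideanSpace ℝ (Fin p) → ℝ := fun x => ⟪x - ∫ ω, X ω ∂P, β⟫_ℝ with hg
  have hgm : Measurable g := by fun_prop
  have hgX : P.map (centeredIndex P X β) = (P.map X).map g := by
    rw [Measure.map_map hgm hXm]; rfl
  have hμ := Measure.isProbabilityMeasure_map (μ := P) hXm.aemeasurable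
  set κ := condDistrib Y A P with hκ
  have hκmean : ∀ᵐ a ∂(P.map A), ∫ y, y ∂(κ a) = a + ∫ ω, Y ω ∂P := by
    rw [ae_map_iff hA.aemeasurable (measurableSet_eq_fun
      (StronglyMeasurable.integral_kernel (f := fun y : ℝ => y) stronglyMeasurable_id).measurable
      (by fun_prop))]
    filter_upwards [condExp_ae_eq_integral_condDistrib' hA hY, hc] with ω h1 h2
    rw [← h1, h2]
  -- Given `X = x`, draw `Y` from its conditional law given `A = g x`; equality of the laws of `g X`
  -- and `A` restores the marginal of `Y`.
  set γ := (P.map X) ⊗ₘ (κ.comap g hgm) with hγ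
  have hfst : γ.map Prod.fst = P.map X := Measure.fst_compProd _ _
  have hsnd : γ.map Prod.snd = P.map Y := by
    change γ.snd = _
    rw [hγ, Measure.snd_compProd, ← condDistrib_comp_map hA.aemeasurable hYm.aemeasurable, ← hlaw,
      hgX]
    ext s hs
    rw [Measure.bind_apply hs (Kernel.aemeasurable _), Measure.bind_apply hs (Kernel.aemeasurable _),
      lintegral_map (Kernel.measurable_coe _ hs) hgm]
    rfl
  refine ⟨γ, hfst, hsnd, fun B hB => ?_⟩
  have hYγ : Integrable (fun z : EuclideanSpace ℝ (Fin p) × ℝ => z.2) γ := by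
    have h1 : IdentDistrib Prod.snd Y γ P := ⟨by fun_prop, hYm.aemeasurable, hsnd⟩
    exact h1.symm.integrable_snd hY
  have hXγ : Integrable (fun z : EuclideanSpace ℝ (Fin p) × ℝ => z.1) γ := by
    have h1 : IdentDistrib Prod.fst X γ P := ⟨by fun_prop, hXm.aemeasurable, hfst⟩
    exact h1.symm.integrable_snd hX
  have hi1 : Integrable (fun z : EuclideanSpace ℝ (Fin p) × ℝ => z.2 - ∫ ω, Y ω ∂P) γ :=
    hYγ.sub (integrable_const _)
  have hi2 : Integrable (fun z : EuclideanSpace ℝ (Fin p) × ℝ => g z.1) γ :=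
    (hXγ.sub (integrable_const _)).inner_const β
  have hBe : Prod.fst ⁻¹' B = B ×ˢ (Set.univ : Set ℝ) := by ext; simp
  rw [hBe, hγ, Measure.setIntegral_compProd hB MeasurableSet.univ hi1.integrableOn,
    Measure.setIntegral_compProd hB MeasurableSet.univ hi2.integrableOn]
  refine integral_congr_ae (ae_restrict_of_ae ?_)
  have hY_int : ∀ᵐ x ∂(P.map X), Integrable (fun y => y) ((κ.comap g hgm) x) :=
    ((Measure.integrable_compProd_iff hYγ.aestronglyMeasurable).1 hYγ).1
  have hmean : ∀ᵐ x ∂(P.map X), ∫ y, y ∂(κ (g x)) = g x + ∫ ω, Y ω ∂P := by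
    rw [← hlaw, hgX] at hκmean
    exact ae_of_ae_map hgm.aemeasurable hκmean
  filter_upwards [hY_int, hmean] with x h1 h2
  simp only [Measure.restrict_univ]
  rw [integral_sub h1 (integrable_const _), Kernel.comap_apply, h2]
  simp

end Coupling

/-! ### Consequences of the linear model and the outer inclusion. -/

section Model

variable {Ω : Type*} [MeasurableSpace Ω] {P : Measure Ω} [IsProbabilityMeasure P] {p : ℕ}
  {X : Ω → EuclideanSpace ℝ (Fin p)} {Y : Ω → ℝ} {β₀ : EuclideanSpace ℝ (Fin p)}

/-- An almost surely constant index has zero covariance with each coordinate, so `q` would lie in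
the kernel of the variance matrix. -/
theorem not_centeredIndex_ae_eq_zero (hX : MemLp X 2 P) (hdet : (varianceMatrix P X).det ≠ 0)
    {q : EuclideanSpace ℝ (Fin p)} (hq : q ≠ 0) : ¬ centeredIndex P X q =ᵐ[P] 0 := by
  intro h0
  refine hq ?_
  have hcoord : ∀ i, MemLp (fun ω => X ω i) 2 P := fun i =>
    (EuclideanSpace.proj (𝕜 := ℝ) i).comp_memLp' hX
  have hv : (varianceMatrix P X).mulVec q.ofLp = 0 := by
    funext i
    have hsum : (fun ω => ∑ j, q j * X ω j) =ᵐ[P] fun _ => ⟪∫ ω', X ω' ∂P, q⟫_ℝ := by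
      filter_upwards [h0] with ω hω
      simp only [centeredIndex, centered, inner_sub_left, Pi.zero_apply] at hω
      have e : ⟪X ω, q⟫_ℝ = ∑ j, q j * X ω j := by simp [PiLp.inner_apply]
      linarith
    have h1 : cov[fun ω => X ω i, fun ω => ∑ j, q j * X ω j; P] = 0 := by
      have hint := integral_congr_ae hsum
      simp only [integral_const, probReal_univ, one_smul] at hint
      rw [covariance, hint]
      refine integral_eq_zero_of_ae ?_
      filter_upwards [hsum] with ω hω
      simp [hω]
    rw [covariance_fun_sum_right (fun j => (hcoord j).const_mul (q j)) (hcoord i)] at h1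
    simp only [covariance_const_mul_right] at h1
    simp only [Matrix.mulVec, dotProduct, varianceMatrix, Matrix.of_apply, Pi.zero_apply]
    rw [← h1]
    exact Finset.sum_congr rfl fun j _ => mul_comm _ _
  have := Matrix.eq_zero_of_mulVec_eq_zero hdet hv
  ext i
  exact congrFun this i

theorem LinearModel.integrable_X (h : LinearModel P X Y β₀) : Integrable X P :=
  h.sq_integrable_X.integrable one_le_two

theorem LinearModel.integrable_Y (h : LinearModel P X Y β₀) : Integrable Y P :=
  h.sq_integrable_Y.integrable one_le_two

theorem LinearModel.condExp_eq_centeredIndex (h : LinearModel P X Y β₀) :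
    P[Y | MeasurableSpace.comap X inferInstance] =ᵐ[P]
      fun ω => centeredIndex P X β₀ ω + ∫ ω', Y ω' ∂P := by
  obtain ⟨a, ha⟩ := h.condExp_eq
  have hi : Integrable (fun ω => ⟪X ω, β₀⟫_ℝ) P := h.integrable_X.inner_const β₀
  have hI := integral_condExp (μ := P) (f := Y) h.measurable_X.comap_le
  have e : ∫ ω, ⟪X ω, β₀⟫_ℝ ∂P = ⟪∫ ω, X ω ∂P, β₀⟫_ℝ := by
    rw [real_inner_comm, ← integral_inner (𝕜 := ℝ) h.integrable_X β₀]
    exact integral_congr_ae (ae_of_all _ fun ω => real_inner_comm _ _)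
  rw [integral_congr_ae ha, integral_add (integrable_const _) hi, e] at hI
  simp only [integral_const, probReal_univ, one_smul] at hI
  filter_upwards [ha] with ω hω
  rw [hω, ← hI]
  simp only [centeredIndex, centered, inner_sub_left]
  ring

theorem LinearModel.condExp_comap_centeredIndex (h : LinearModel P X Y β₀) :
    P[Y | MeasurableSpace.comap (centeredIndex P X β₀) inferInstance] =ᵐ[P]
      fun ω => centeredIndex P X β₀ ω + ∫ ω', Y ω' ∂P := by
  have hX := h.measurable_X
  have hA := measurable_centeredIndex (P := P) hX β₀
  have hg : Measurable fun x : EuclideanSpace ℝ (Fin p) => ⟪x - ∫ ω, X ω ∂P, β₀⟫_ℝ := by fun_prop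
  have hle : MeasurableSpace.comap (centeredIndex P X β₀) inferInstance ≤
      MeasurableSpace.comap X inferInstance := by
    rw [show centeredIndex P X β₀ = (fun x => ⟪x - ∫ ω, X ω ∂P, β₀⟫_ℝ) ∘ X from rfl,
      ← MeasurableSpace.comap_comp]
    exact MeasurableSpace.comap_mono hg.comap_le
  have h1 := condExp_condExp_of_le (μ := P) (f := Y) hle hX.comap_le
  refine h1.symm.trans ((condExp_congr_ae h.condExp_eq_centeredIndex).trans ?_)
  rw [condExp_of_stronglyMeasurable hA.comap_le]
  · exact ((comap_measurable _).add_const _).stronglyMeasurable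
  · exact (integrable_centeredIndex h.integrable_X β₀).add (integrable_const _)

/-- Conditioning on a constant makes the coupling a product. -/
theorem exists_isMeanCoupling_zero (h : LinearModel P X Y β₀) :
    ∃ γ, IsMeanCoupling P X Y 0 γ := by
  refine exists_isMeanCoupling_of_condExp h.measurable_X h.measurable_Y h.integrable_X
    h.integrable_Y (A := fun _ => 0) measurable_const (by rw [centeredIndex_zero]) ?_
  rw [MeasurableSpace.comap_const, condExp_bot]
  simp

theorem identifiedSet_subset_regularizedSet (hp : 1 ≤ p) (h : LinearModel P X Y β₀) {ε : ℝ}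
    (hε : 0 < ε) (hε' : ε < 1 / 2) : identifiedSet P X Y ⊆ regularizedSet P X Y ε := by
  intro β hβ
  have hα {α : ℝ} (h : α ∈ Set.Icc ε (1 - ε)) : α ∈ Set.Ioo (0 : ℝ) 1 :=
    ⟨hε.trans_le h.1, h.2.trans_lt (by linarith)⟩
  have hYc := integrable_centered (P := P) h.integrable_Y
  have hY0 := integral_centered (P := P) h.integrable_Y
  by_cases h0 : β = 0
  -- The zero vector still needs a unit direction, whence `1 ≤ p`, and a nonnegative `regS`.
  · refine ⟨EuclideanSpace.single ⟨0, hp⟩ 1, 0, by simp, le_rfl, ?_, by simp [h0]⟩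
    refine Real.sInf_nonneg ?_
    rintro _ ⟨α, hαm, rfl⟩
    exact div_nonneg (superquantile_nonneg hYc hY0 (hα hαm)) (superquantile_nonneg
      (integrable_centeredIndex h.integrable_X _) (integral_centeredIndex h.integrable_X _) (hα hαm))
  · have hn : 0 < ‖β‖ := norm_pos_iff.2 h0
    refine ⟨‖β‖⁻¹ • β, ‖β‖, ?_, hn.le, ?_, (smul_inv_smul₀ hn.ne' β).symm⟩
    · rw [norm_smul, norm_inv, norm_norm, inv_mul_cancel₀ hn.ne']
    · refine le_csInf ((Set.nonempty_Icc.2 (by linarith)).image _) ?_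
      rintro _ ⟨α, hαm, rfl⟩
      have hq : ‖β‖⁻¹ • β ≠ 0 := smul_ne_zero (inv_ne_zero hn.ne') h0
      have hi := integrable_centeredIndex (P := P) h.integrable_X (‖β‖⁻¹ • β)
      have hpos := superquantile_pos hi (integral_centeredIndex h.integrable_X _)
        (not_centeredIndex_ae_eq_zero h.sq_integrable_X h.variance_X_nonsingular hq) (hα hαm)
      have hmono := superquantile_mono (integrable_centeredIndex h.integrable_X β) hYc (hα hαm)
        (integral_max_sub_le_of_mem_identifiedSet h.integrable_X h.integrable_Y hβ)
      have hsc := superquantile_const_mul hi (hα hαm) hn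
      rw [← centeredIndex_smul, smul_inv_smul₀ hn.ne'] at hsc
      rw [hsc] at hmono
      exact (le_div_iff₀ hpos).2 hmono

/-- Points of `B_ε` have norm at most the ratio of superquantiles at the level `1 - ε`. -/
theorem le_ratioR_of_le_regS (h : LinearModel P X Y β₀) {ε l : ℝ} {q : EuclideanSpace ℝ (Fin p)}
    (hε : 0 < ε) (hε' : ε < 1 / 2)
    (hl : l ≤ regS ε (cdfOf P (centered P Y)) (cdfOf P (centeredIndex P X q))) :
    l ≤ superquantile P (centered P Y) (1 - ε) /
      superquantile P (centeredIndex P X q) (1 - ε) := by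
  -- The ratios are bounded below by `0`, so the real infimum is a genuine lower bound.
  refine hl.trans (csInf_le ⟨0, ?_⟩ ⟨1 - ε, ⟨by linarith, le_rfl⟩, rfl⟩)
  rintro _ ⟨α, hαm, rfl⟩
  have hα : α ∈ Set.Ioo (0 : ℝ) 1 := ⟨hε.trans_le hαm.1, hαm.2.trans_lt (by linarith)⟩
  exact div_nonneg (superquantile_nonneg (integrable_centered h.integrable_Y)
    (integral_centered h.integrable_Y) hα) (superquantile_nonneg
      (integrable_centeredIndex h.integrable_X _) (integral_centeredIndex h.integrable_X _) hα)

/-- The first absolute moment of the index is bounded away from zero on the unit sphere. -/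
theorem exists_pos_le_integral_abs_centeredIndex (h : LinearModel P X Y β₀) :
    ∃ v : ℝ, 0 < v ∧ ∀ q : EuclideanSpace ℝ (Fin p), ‖q‖ = 1 →
      v ≤ ∫ ω, |centeredIndex P X q ω| ∂P := by
  have hcont : Continuous fun q : EuclideanSpace ℝ (Fin p) =>
      ∫ ω, |centeredIndex P X q ω| ∂P := by
    refine continuous_iff_continuousAt.2 fun q₀ => ?_
    refine continuousAt_of_dominated (bound := fun ω => ‖centered P X ω‖ * (‖q₀‖ + 1))
      (Eventually.of_forall fun q =>
        (integrable_centeredIndex h.integrable_X q).abs.aestronglyMeasurable) ?_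
      ((integrable_centered h.integrable_X).norm.mul_const _)
      (ae_of_all _ fun ω => by unfold centeredIndex; fun_prop)
    have hev : ∀ᶠ q in 𝓝 q₀, ‖q‖ < ‖q₀‖ + 1 :=
      continuous_norm.continuousAt.eventually_lt continuousAt_const (by simp)
    filter_upwards [hev] with q hq
    refine ae_of_all _ fun ω => ?_
    rw [Real.norm_eq_abs, abs_abs]
    exact (abs_real_inner_le_norm _ _).trans (by gcongr)
  have hpos : ∀ q : EuclideanSpace ℝ (Fin p), ‖q‖ = 1 →
      0 < ∫ ω, |centeredIndex P X q ω| ∂P := by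
    intro q hq
    refine lt_of_le_of_ne (integral_nonneg fun ω => abs_nonneg _) fun he => ?_
    have := (integral_eq_zero_iff_of_nonneg (fun ω => abs_nonneg _)
      (integrable_centeredIndex h.integrable_X q).abs).1 he.symm
    refine not_centeredIndex_ae_eq_zero h.sq_integrable_X h.variance_X_nonsingular
      (q := q) (by rintro rfl; simp at hq) ?_
    filter_upwards [this] with ω hω
    simpa using hω
  by_cases hne : (Metric.sphere (0 : EuclideanSpace ℝ (Fin p)) 1).Nonempty
  · obtain ⟨q₀, hq₀, hmin⟩ := (isCompact_sphere _ _).exists_isMinOn hne hcont.continuousOn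
    exact ⟨_, hpos q₀ (by simpa using hq₀), fun q hq => hmin (by simpa using hq)⟩
  · exact ⟨1, one_pos, fun q hq => absurd ⟨q, by simpa using hq⟩ hne⟩

end Model

/-! ### Elliptical laws: all indices agree up to scale. -/

section Elliptical

variable {Ω : Type*} [MeasurableSpace Ω] {P : Measure Ω} [IsProbabilityMeasure P] {p : ℕ}
  {X : Ω → EuclideanSpace ℝ (Fin p)}

/-- The centred version of an elliptical vector has characteristic function `t ↦ ψ(t'Mt)`. -/
theorem IsElliptical.exists_charFun_centered (hXm : Measurable X) (hX : Integrable X P)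
    (h : IsElliptical (P.map X)) :
    ∃ (M : Matrix (Fin p) (Fin p) ℝ) (ψ : ℝ → ℂ), M.PosSemidef ∧
      ∀ t, charFun (P.map (centered P X)) t = ψ (t.ofLp ⬝ᵥ (M.mulVec t.ofLp)) := by
  obtain ⟨m, M, ψ, hM, hψ⟩ := h
  have h1 : ∀ t, charFun (P.map fun ω => X ω - m) t = ψ (t.ofLp ⬝ᵥ (M.mulVec t.ofLp)) := by
    intro t
    have e : P.map (fun ω => X ω - m) = (P.map X).map (· + -m) := by
      rw [Measure.map_map (by fun_prop) hXm]
      simp [Function.comp_def, sub_eq_add_neg]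
    rw [e, charFun_map_add_const, hψ, mul_right_comm, ← Complex.exp_add]
    simp [real_inner_comm m t]
  -- The characteristic function of `X - m` is even, so its law is symmetric; this identifies `m`
  -- with the mean.
  have h2 : P.map (fun ω => X ω - m) = P.map fun ω => (-1 : ℝ) • (X ω - m) := by
    have i1 := Measure.isProbabilityMeasure_map (μ := P) (f := fun ω => X ω - m) (by fun_prop)
    have i2 := Measure.isProbabilityMeasure_map (μ := P) (f := fun ω => (-1 : ℝ) • (X ω - m))
      (by fun_prop)
    refine Measure.ext_of_charFun (funext fun t => ?_)
    rw [charFun_map_smul_comp (by fun_prop), h1, h1]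
    simp [Matrix.mulVec_neg]
  have h3 : IdentDistrib (fun ω => X ω - m) (fun ω => (-1 : ℝ) • (X ω - m)) P P :=
    ⟨by fun_prop, by fun_prop, h2⟩
  have h4 := h3.integral_eq
  rw [integral_smul, integral_sub hX (integrable_const _)] at h4
  simp only [integral_const, probReal_univ, one_smul, neg_smul] at h4
  have h5 : ∫ ω, X ω ∂P = m := by
    rw [← sub_eq_zero]
    rw [eq_neg_iff_add_eq_zero, ← two_smul ℝ, smul_eq_zero] at h4
    exact h4.resolve_left two_ne_zero
  refine ⟨M, ψ, hM, fun t => ?_⟩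
  rw [← h1 t, ← h5]
  rfl

/-- All the indices of an elliptical vector are rescalings of one another in law. -/
theorem IsElliptical.exists_map_centeredIndex_eq (hXm : Measurable X) (hX : Integrable X P)
    (h : IsElliptical (P.map X)) {q r : EuclideanSpace ℝ (Fin p)}
    (hq : ¬ centeredIndex P X q =ᵐ[P] 0) (hr : ¬ centeredIndex P X r =ᵐ[P] 0) :
    ∃ s : ℝ, 0 < s ∧
      P.map (centeredIndex P X q) = P.map fun ω => s * centeredIndex P X r ω := by
  obtain ⟨M, ψ, hM, hψ⟩ := h.exists_charFun_centered hXm hX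
  have hXc := measurable_centered (P := P) hXm
  have hI := measurable_centeredIndex (P := P) hXm
  set Q : EuclideanSpace ℝ (Fin p) → ℝ := fun t => t.ofLp ⬝ᵥ (M.mulVec t.ofLp) with hQ
  have hQ0 : ∀ t, 0 ≤ Q t := fun t => by simpa using hM.dotProduct_mulVec_nonneg t.ofLp
  have hcf : ∀ t (x : ℝ), charFun (P.map (centeredIndex P X t)) x = ψ (x ^ 2 * Q t) := by
    intro t x
    have e : charFun (P.map (centeredIndex P X t)) x =
        charFun (P.map (centered P X)) (x • t) := by
      rw [charFun_apply, charFun_apply, integral_map (hI t).aemeasurable (by fun_prop),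
        integral_map hXc.aemeasurable (by fun_prop)]
      simp [centeredIndex, real_inner_smul_right, mul_comm]
    rw [e, hψ]
    congr 1
    simp only [hQ, WithLp.ofLp_smul, Matrix.mulVec_smul, smul_dotProduct, dotProduct_smul,
      smul_eq_mul]
    ring
  have hprob := fun t => Measure.isProbabilityMeasure_map (μ := P) (hI t).aemeasurable
  have hψ0 : ψ 0 = 1 := by
    have := hcf q 0
    simpa using this.symm
  have hpos : ∀ t, ¬ centeredIndex P X t =ᵐ[P] 0 → 0 < Q t := by
    intro t ht
    -- If `Q t = 0`, the characteristic function of the index is constantly `1`, so the index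
    -- vanishes almost surely.
    refine lt_of_le_of_ne (hQ0 t) fun h0 => ht ?_
    have hd : P.map (centeredIndex P X t) = Measure.dirac 0 := by
      refine Measure.ext_of_charFun (funext fun x => ?_)
      rw [hcf, ← h0, mul_zero, hψ0, charFun_dirac]
      simp
    have : ∀ᵐ x ∂(P.map (centeredIndex P X t)), x = 0 := by
      rw [hd, ae_dirac_eq]
      simp
    exact ae_of_ae_map (hI t).aemeasurable this
  have hq' := hpos q hq
  have hr' := hpos r hr
  refine ⟨√(Q q / Q r), by positivity, ?_⟩
  have i2 := Measure.isProbabilityMeasure_map (μ := P)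
    (f := fun ω => √(Q q / Q r) * centeredIndex P X r ω) ((hI r).const_mul _).aemeasurable
  refine Measure.ext_of_charFun (funext fun x => ?_)
  rw [charFun_map_mul_comp (hI r).aemeasurable, hcf, hcf, mul_pow, Real.sq_sqrt (by positivity)]
  congr 1
  field_simp

end Elliptical

/-! ### From polynomial tails to powers of `ε`. -/

section Tails

variable {Ω : Type*} [MeasurableSpace Ω] {P : Measure Ω} [IsProbabilityMeasure P]

/-- A polynomial upper tail bound gives a polynomial upper bound on the superquantile. -/
theorem exists_superquantile_le_rpow {U : Ω → ℝ} (hU : Integrable U P) {d : ℝ} (hd : 1 < d)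
    (h : limsup (fun x : ℝ => ENNReal.ofReal (x ^ d) * survival P (fun ω => |U ω|) x) atTop < ⊤) :
    ∃ K : ℝ, 0 < K ∧ ∀ᶠ ε in 𝓝[>] (0 : ℝ), superquantile P U (1 - ε) ≤ K * ε ^ (1 - 1 / d) := by
  obtain ⟨C, hC, -⟩ := ENNReal.lt_iff_exists_nnreal_btwn.1 h
  obtain ⟨x₀, hx₀⟩ := eventually_atTop.1 (eventually_lt_of_limsup_lt hC)
  have hd0 : 0 < d := by linarith
  have hsurv : ∀ x, max x₀ 1 ≤ x →
      survival P (fun ω => |U ω|) x ≤ ENNReal.ofReal (C * x ^ (-d)) := by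
    intro x hx
    have hx1 : 0 < x := one_pos.trans_le ((le_max_right _ _).trans hx)
    have h1 := (hx₀ x ((le_max_left _ _).trans hx)).le
    rw [Real.rpow_neg hx1.le, ← div_eq_mul_inv, ENNReal.ofReal_div_of_pos (by positivity),
      ENNReal.le_div_iff_mul_le (.inl (by simp [Real.rpow_pos_of_pos hx1])) (.inl (by simp)),
      mul_comm, ENNReal.ofReal_coe_nnreal]
    exact h1
  refine ⟨1 + C / (d - 1), by have := sub_pos.2 hd; positivity, ?_⟩
  -- The threshold `t = ε^(-1/d)` balances `t ε` against the mean excess bound, of order `t^(1 -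
  -- d)`.
  have ht : Tendsto (fun ε : ℝ => ε ^ (-(1 / d))) (𝓝[>] 0) atTop :=
    tendsto_rpow_neg_nhdsGT_zero (by simpa using hd0)
  filter_upwards [ht.eventually_ge_atTop (max x₀ 1), Ioo_mem_nhdsGT (one_pos (α := ℝ))] with ε h1 h2
  have hε := h2.1
  have hα : 1 - ε ∈ Set.Ioo (0 : ℝ) 1 := ⟨by linarith [h2.2], by linarith⟩
  have h3 := superquantile_le hU hα (ε ^ (-(1 / d)))
  have h4 := integral_max_sub_le_of_survival_le hU hd (Real.rpow_pos_of_pos hε _) h1 hsurv C.2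
  have e1 : ε ^ (-(1 / d)) * ε = ε ^ (1 - 1 / d) := by
    nth_rewrite 2 [← Real.rpow_one ε]
    rw [← Real.rpow_add hε]
    congr 1
    ring
  have e2 : (ε ^ (-(1 / d))) ^ (1 - d) = ε ^ (1 - 1 / d) := by
    rw [← Real.rpow_mul hε.le]
    congr 1
    field_simp
    ring
  rw [e2] at h4
  rw [sub_sub_cancel, e1] at h3
  calc _ ≤ _ := h3
    _ ≤ ε ^ (1 - 1 / d) + C * (ε ^ (1 - 1 / d) / (d - 1)) := by gcongr
    _ = _ := by ring

/-- A polynomial lower tail bound gives a polynomial lower bound on the superquantile. -/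
theorem rpow_le_superquantile {A : Ω → ℝ} (hA : Integrable A P) {c x₀ r ε : ℝ} (hc : 0 < c)
    (hr : 0 < r) (hx₀ : 0 < x₀)
    (h : ∀ x, x₀ ≤ x → ENNReal.ofReal r < ENNReal.ofReal (x ^ c) * survival P A x)
    (hε : 0 < ε) (hε1 : ε < 1) (hεr : ε ≤ r / x₀ ^ c) :
    r ^ (1 / c) * ε ^ (1 - 1 / c) ≤ superquantile P A (1 - ε) := by
  -- This threshold solves `r x^(-c) = ε`, so it has survival above `ε`.
  have hx : x₀ ≤ (r / ε) ^ (1 / c) := by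
    rw [one_div, Real.le_rpow_inv_iff_of_pos hx₀.le (by positivity) hc]
    rw [le_div_iff₀ (by positivity)] at hεr ⊢
    linarith
  have h1 := h _ hx
  have e : ((r / ε) ^ (1 / c)) ^ c = r / ε := by
    rw [← Real.rpow_mul (by positivity), one_div_mul_cancel hc.ne', Real.rpow_one]
  rw [e] at h1
  have h2 : ENNReal.ofReal ε < survival P A ((r / ε) ^ (1 / c)) := by
    have e2 : ENNReal.ofReal r = ENNReal.ofReal (r / ε) * ENNReal.ofReal ε := by
      rw [← ENNReal.ofReal_mul (by positivity), div_mul_cancel₀ _ hε.ne']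
    rw [e2] at h1
    exact lt_of_mul_lt_mul_left' h1
  have h3 := mul_le_superquantile_of_lt_survival hA ⟨hε, hε1⟩ h2
  have e3 : (r / ε) ^ (1 / c) * ε = r ^ (1 / c) * ε ^ (1 - 1 / c) := by
    rw [Real.div_rpow hr.le hε.le, Real.rpow_sub hε, Real.rpow_one]
    ring
  rwa [e3] at h3

/-- An integrable variable cannot have a tail heavier than `1 / x`. -/
theorem one_le_of_lt_rpow_mul_survival {A : Ω → ℝ} (hA : Integrable A P) {c r : ℝ} (hr : 0 < r)
    (h : ∀ᶠ x : ℝ in atTop, ENNReal.ofReal r < ENNReal.ofReal (x ^ c) * survival P A x) :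
    1 ≤ c := by
  by_contra! hc
  have hlim : Tendsto (fun x : ℝ => x ^ (c - 1) * ∫ ω, |A ω| ∂P) atTop (𝓝 0) := by
    have := (tendsto_rpow_neg_atTop (show 0 < 1 - c by linarith)).mul_const (∫ ω, |A ω| ∂P)
    simpa using this
  obtain ⟨x, hx, hlt, hx1⟩ := (h.and ((hlim.eventually_lt_const hr).and
    (eventually_gt_atTop 0))).exists
  -- By Markov, `x^c P(A > x)` is at most `x^(c - 1) E|A|`, which tends to `0` when `c < 1`.
  have hmk := mul_meas_ge_le_integral_of_nonneg (ae_of_all P fun ω => abs_nonneg (A ω)) hA.abs x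
  have hsub : P.real {ω | x < A ω} ≤ P.real {ω | x ≤ |A ω|} :=
    measureReal_mono fun ω hω => (show x < A ω from hω).le.trans (le_abs_self _)
  have hs : survival P A x = ENNReal.ofReal (P.real {ω | x < A ω}) :=
    (ofReal_measureReal).symm
  rw [hs, ← ENNReal.ofReal_mul (by positivity), ENNReal.ofReal_lt_ofReal_iff_of_nonneg hr.le] at hx
  have e : x ^ c = x ^ (c - 1) * x := by
    rw [Real.rpow_sub_one hx1.ne', div_mul_cancel₀ _ hx1.ne']
  have h5 : x * P.real {ω | x < A ω} ≤ ∫ ω, |A ω| ∂P :=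
    (mul_le_mul_of_nonneg_left hsub hx1.le).trans hmk
  have h6 := mul_le_mul_of_nonneg_left h5 (Real.rpow_nonneg hx1.le (c - 1))
  rw [e, mul_assoc] at hx
  linarith

omit [IsProbabilityMeasure P] in
/-- A polynomial lower bound on the density gives a polynomial lower bound on the tail. -/
theorem exists_lt_rpow_mul_survival_of_density {A : Ω → ℝ} (hA : Measurable A) {c : ℝ} (hc : 0 < c)
    {f : ℝ → ℝ≥0∞} (hdens : P.map A = volume.withDensity f)
    (h : 0 < liminf (fun x : ℝ => ENNReal.ofReal (|x| ^ (1 + c)) * f x)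
      (comap (fun x => |x|) atTop)) :
    ∃ r x₀ : ℝ, 0 < r ∧ 0 < x₀ ∧
      ∀ x, x₀ ≤ x → ENNReal.ofReal r < ENNReal.ofReal (x ^ c) * survival P A x := by
  obtain ⟨r, hr0, hr⟩ := ENNReal.lt_iff_exists_nnreal_btwn.1 h
  have hr0' : 0 < (r : ℝ) := by exact_mod_cast hr0
  obtain ⟨s, hs, hsub⟩ := mem_comap.1 (eventually_lt_of_lt_liminf hr)
  obtain ⟨x₀, hx₀⟩ := mem_atTop_sets.1 hs
  have hf : ∀ y, max x₀ 1 ≤ y → (r : ℝ≥0∞) < ENNReal.ofReal (y ^ (1 + c)) * f y := by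
    intro y hy
    have hy1 : 0 < y := one_pos.trans_le ((le_max_right _ _).trans hy)
    have := hsub (show y ∈ (fun x : ℝ => |x|) ⁻¹' s from
      hx₀ _ (((le_max_left _ _).trans hy).trans (le_abs_self y)))
    simpa [abs_of_pos hy1] using this
  -- Integrating the density over `(x, 2x]` yields `r / 2^(1 + c)`; the extra half makes the
  -- inequality strict.
  refine ⟨r / 2 ^ (1 + c) / 2, max x₀ 1, by positivity, by positivity, fun x hx => ?_⟩
  have hx1 : 0 < x := one_pos.trans_le ((le_max_right _ _).trans hx)
  have hsurv : survival P A x = ∫⁻ y in Set.Ioi x, f y := by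
    rw [← withDensity_apply _ measurableSet_Ioi, ← hdens, Measure.map_apply hA measurableSet_Ioi]
    rfl
  have h1 : ∀ y ∈ Set.Ioc x (2 * x), ENNReal.ofReal (r / (2 * x) ^ (1 + c)) ≤ f y := by
    intro y hy
    have hy0 : 0 < y := hx1.trans hy.1
    have h2 := (hf y (hx.trans hy.1.le)).le
    have h3 : (r : ℝ≥0∞) ≤ ENNReal.ofReal ((2 * x) ^ (1 + c)) * f y := by
      refine h2.trans ?_
      gcongr
      exact hy.2
    rw [ENNReal.ofReal_div_of_pos (by positivity), ENNReal.ofReal_coe_nnreal]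
    refine ENNReal.div_le_of_le_mul ?_
    rwa [mul_comm]
  have h2 : ENNReal.ofReal (r / (2 * x) ^ (1 + c)) * ENNReal.ofReal x ≤ survival P A x := by
    rw [hsurv]
    calc _ = ∫⁻ y in Set.Ioc x (2 * x), ENNReal.ofReal (r / (2 * x) ^ (1 + c)) := by
          rw [setLIntegral_const, Real.volume_Ioc]
          congr 2
          ring
      _ ≤ ∫⁻ y in Set.Ioc x (2 * x), f y := setLIntegral_mono' measurableSet_Ioc h1
      _ ≤ _ := lintegral_mono_set Set.Ioc_subset_Ioi_self
  refine lt_of_lt_of_le ?_ (mul_le_mul_right h2 _)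
  rw [← ENNReal.ofReal_mul (by positivity), ← ENNReal.ofReal_mul (by positivity)]
  have e : x ^ c * (r / (2 * x) ^ (1 + c) * x) = r / 2 ^ (1 + c) := by
    rw [Real.mul_rpow (by norm_num) hx1.le, Real.rpow_add hx1, Real.rpow_one]
    have := (Real.rpow_pos_of_pos hx1 c).ne'
    field_simp
  rw [e]
  refine (ENNReal.ofReal_lt_ofReal_iff (by positivity)).2 (half_lt_self (by positivity))

end Tails

theorem hausdorffEDist_le_of_subset_of_forall {E : Type*} [SeminormedAddCommGroup E] {B C : Set E}
    {r : ℝ} (hBC : B ⊆ C) (h : ∀ x ∈ C, ∃ y ∈ B, ‖x - y‖ ≤ r) :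
    Metric.hausdorffEDist B C ≤ ENNReal.ofReal r := by
  refine Metric.hausdorffEDist_le_of_mem_edist (fun x hx => ⟨x, hBC hx, by simp⟩) fun x hx => ?_
  obtain ⟨y, hy, hxy⟩ := h x hx
  refine ⟨y, hy, ?_⟩
  rw [edist_dist, dist_eq_norm]
  exact ENNReal.ofReal_le_ofReal hxy

/-! ### The segment in the identified set and the two Hausdorff rates. -/

section Rates

variable {Ω : Type*} [MeasurableSpace Ω] {P : Measure Ω} [IsProbabilityMeasure P] {p : ℕ}
  {X : Ω → EuclideanSpace ℝ (Fin p)} {Y : Ω → ℝ} {β₀ : EuclideanSpace ℝ (Fin p)}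

/-- If `X₀'q` has the law of `s X₀'β₀`, the identified set contains the segment from the origin to
`s⁻¹ q`. -/
theorem smul_mem_identifiedSet (h : LinearModel P X Y β₀) {q : EuclideanSpace ℝ (Fin p)} {s l : ℝ}
    (hs : 0 < s) (hlaw : P.map (centeredIndex P X q) = P.map fun ω => s * centeredIndex P X β₀ ω)
    (hl0 : 0 ≤ l) (hl : l ≤ s⁻¹) : l • q ∈ identifiedSet P X Y := by
  have hA := measurable_centeredIndex (P := P) h.measurable_X β₀
  have hq := measurable_centeredIndex (P := P) h.measurable_X q
  have hlaw' : P.map (centeredIndex P X (s⁻¹ • q)) = P.map (centeredIndex P X β₀) := by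
    have h1 : P.map (centeredIndex P X (s⁻¹ • q)) =
        (P.map (centeredIndex P X q)).map (fun x => s⁻¹ * x) := by
      rw [Measure.map_map (by fun_prop) hq, centeredIndex_smul]
      rfl
    rw [h1, hlaw, Measure.map_map (by fun_prop) (hA.const_mul s)]
    congr 1
    funext ω
    exact inv_mul_cancel_left₀ hs.ne' _
  obtain ⟨γ₁, hγ₁⟩ := exists_isMeanCoupling_of_condExp h.measurable_X h.measurable_Y
    h.integrable_X h.integrable_Y hA hlaw' h.condExp_comap_centeredIndex
  obtain ⟨γ₂, hγ₂⟩ := exists_isMeanCoupling_zero h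
  have hls : l * s ≤ 1 := by
    have := mul_le_mul_of_nonneg_right hl hs.le
    rwa [inv_mul_cancel₀ hs.ne'] at this
  -- Weights `l s` on `s⁻¹ q` and `1 - l s` on `0` average to `l q`.
  have hab : (⟨l * s, by positivity⟩ : NNReal) + ⟨1 - l * s, sub_nonneg.2 hls⟩ = 1 :=
    NNReal.eq (add_sub_cancel (l * s) 1)
  have hmem := (hγ₁.convexCombination h.measurable_X h.measurable_Y h.integrable_X
    h.integrable_Y hγ₂ hab).mem_identifiedSet h.measurable_X h.measurable_Y h.integrable_X
    h.integrable_Y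
  have e : (l * s) • s⁻¹ • q + (1 - l * s) • (0 : EuclideanSpace ℝ (Fin p)) = l • q := by
    rw [smul_zero, add_zero, smul_smul, mul_assoc, mul_inv_cancel₀ hs.ne', mul_one]
  rw [← e]
  exact hmem

theorem rpow_tail_ratio {ε k K c d a b : ℝ} (hε : 0 < ε) (hk : 0 < k) (hK : 0 < K)
    (ha : a ≤ K * ε ^ (1 - 1 / d)) (hb : k * ε ^ (1 - 1 / c) ≤ b) :
    a / b ≤ K / k * ε ^ (1 / c - 1 / d) := by
  have hb0 : 0 < k * ε ^ (1 - 1 / c) := by positivity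
  calc a / b ≤ K * ε ^ (1 - 1 / d) / b := by
        gcongr
        exact hb0.le.trans hb
    _ ≤ K * ε ^ (1 - 1 / d) / (k * ε ^ (1 - 1 / c)) := by gcongr
    _ = _ := by
        rw [mul_div_mul_comm, ← Real.rpow_sub hε]
        congr 2
        ring

theorem hausdorffEDist_le_of_elliptical (hp : 1 ≤ p) (h : LinearModel P X Y β₀) {U : Ω → ℝ}
    (hU : U = fun ω => centered P Y ω - centeredIndex P X β₀ ω)
    {c d : ℝ} (hc : 1 < c) (hcd : c < d) (hell : IsElliptical (P.map X)) {f : ℝ → ℝ≥0∞}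
    (hdens : P.map (centeredIndex P X β₀) = volume.withDensity f)
    (hf : 0 < liminf (fun x : ℝ => ENNReal.ofReal (|x| ^ (1 + c)) * f x)
      (comap (fun x => |x|) atTop))
    (htail : limsup (fun x : ℝ => ENNReal.ofReal (x ^ d) * survival P (fun ω => |U ω|) x) atTop
      < ⊤) :
    ∃ K : ℝ, 0 < K ∧ ∀ᶠ ε in 𝓝[>] (0 : ℝ),
      Metric.hausdorffEDist (identifiedSet P X Y) (regularizedSet P X Y ε)
        ≤ ENNReal.ofReal (K * ε ^ (1 / c - 1 / d)) := by
  have hc0 : 0 < c := by linarith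
  have hAm := measurable_centeredIndex (P := P) h.measurable_X β₀
  have hAi := integrable_centeredIndex (P := P) h.integrable_X β₀
  have hYi := integrable_centered (P := P) h.integrable_Y
  have hUi : Integrable U P := by rw [hU]; exact hYi.sub hAi
  have hU0 : ∫ ω, U ω ∂P = 0 := by
    rw [hU, integral_sub hYi hAi, integral_centered h.integrable_Y,
      integral_centeredIndex h.integrable_X, sub_zero]
  have hβ₀ : β₀ ≠ 0 := by
    rintro rfl
    -- For `β₀ = 0` the index would have an atom at `0`, which a density excludes.
    have h1 : P.map (centeredIndex P X 0) {0} = 1 := by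
      rw [centeredIndex_zero]
      simp
    rw [hdens, withDensity_absolutelyContinuous _ _ (Real.volume_singleton)] at h1
    exact zero_ne_one h1
  have hne {q : EuclideanSpace ℝ (Fin p)} (hq : q ≠ 0) :=
    not_centeredIndex_ae_eq_zero h.sq_integrable_X h.variance_X_nonsingular hq
  obtain ⟨r, x₀, hr, hx₀, hA⟩ := exists_lt_rpow_mul_survival_of_density hAm hc0 hdens hf
  obtain ⟨K, hK, hKU⟩ := exists_superquantile_le_rpow hUi (by linarith) htail
  obtain ⟨v, hv, hvq⟩ := exists_pos_le_integral_abs_centeredIndex h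
  set a := ∫ ω, |centeredIndex P X β₀ ω| ∂P with ha
  have hanonneg : 0 ≤ a := integral_nonneg fun ω => abs_nonneg _
  have hk : 0 < r ^ (1 / c) := by positivity
  refine ⟨(a + 1) / v * (K / r ^ (1 / c)), by positivity, ?_⟩
  filter_upwards [hKU, Ioo_mem_nhdsGT (show (0 : ℝ) < 1 / 2 by norm_num),
    Ioc_mem_nhdsGT (show 0 < r / x₀ ^ c by positivity)] with ε hεU hε hεr
  have hα : 1 - ε ∈ Set.Ioo (0 : ℝ) 1 := ⟨by linarith [hε.2], by linarith [hε.1]⟩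
  have hεA := rpow_le_superquantile hAi hc0 hr hx₀ hA hε.1 (by linarith [hε.2]) hεr.2
  have hApos := superquantile_pos hAi (integral_centeredIndex h.integrable_X _) (hne hβ₀) hα
  have hUnn := superquantile_nonneg hUi hU0 hα
  have hratio := rpow_tail_ratio hε.1 hk hK hεU hεA
  refine hausdorffEDist_le_of_subset_of_forall
    (identifiedSet_subset_regularizedSet hp h hε.1 hε.2) ?_
  rintro _ ⟨q, l, hq1, hl0, hl, rfl⟩
  have hq0 : q ≠ 0 := by rintro rfl; simp at hq1
  obtain ⟨s, hs, hlaw⟩ := hell.exists_map_centeredIndex_eq h.measurable_X h.integrable_X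
    (hne hq0) (hne hβ₀)
  refine ⟨min l s⁻¹ • q, smul_mem_identifiedSet h hs hlaw (le_min hl0 (inv_pos.2 hs).le)
    (min_le_right _ _), ?_⟩
  rw [← sub_smul, norm_smul, hq1, mul_one, Real.norm_eq_abs,
    abs_of_nonneg (sub_nonneg.2 (min_le_left _ _))]
  -- Equality in law gives `s a = E|X₀'q| ≥ v`, a bound on `s⁻¹` uniform in `q`; `a + 1` is used
  -- only so that the constant is visibly positive.
  have hsv : s⁻¹ ≤ (a + 1) / v := by
    have h1 : ∫ ω, |centeredIndex P X q ω| ∂P = s * a := by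
      have hid : IdentDistrib (centeredIndex P X q) (fun ω => s * centeredIndex P X β₀ ω) P P :=
        ⟨(measurable_centeredIndex h.measurable_X q).aemeasurable,
          (hAm.const_mul s).aemeasurable, hlaw⟩
      have := (hid.comp (u := fun x : ℝ => |x|) (by fun_prop)).integral_eq
      simp only [Function.comp_def, abs_mul, abs_of_pos hs] at this
      rw [this, integral_const_mul]
    have h2 := hvq q hq1
    rw [h1] at h2
    rw [le_div_iff₀ hv, inv_mul_le_iff₀ hs]
    nlinarith
  have hls : l ≤ s⁻¹ * (1 + superquantile P U (1 - ε) /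
      superquantile P (centeredIndex P X β₀) (1 - ε)) := by
    refine (le_ratioR_of_le_regS h hε.1 hε.2 hl).trans ?_
    rw [superquantile_congr hlaw, superquantile_const_mul hAi hα hs]
    have hadd := superquantile_add_le hAi hUi hα
    have e : (fun ω => centeredIndex P X β₀ ω + U ω) = centered P Y := by
      funext ω
      rw [hU]
      ring
    rw [e] at hadd
    rw [div_le_iff₀ (by positivity)]
    refine hadd.trans (le_of_eq ?_)
    field_simp
  have hsi := inv_pos.2 hs
  have hrn : 0 ≤ superquantile P U (1 - ε) / superquantile P (centeredIndex P X β₀) (1 - ε) := by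
    positivity
  have hdiff : l - min l s⁻¹ ≤ s⁻¹ * (superquantile P U (1 - ε) /
      superquantile P (centeredIndex P X β₀) (1 - ε)) := by
    rcases le_total l s⁻¹ with hc' | hc'
    · rw [min_eq_left hc', sub_self]
      positivity
    · rw [min_eq_right hc']
      linarith
  calc _ ≤ _ := hdiff
    _ ≤ (a + 1) / v * (K / r ^ (1 / c) * ε ^ (1 / c - 1 / d)) := by gcongr
    _ = _ := by ring

theorem hausdorffEDist_le_of_eq_zero (hp : 1 ≤ p) (h : LinearModel P X Y 0) {U : Ω → ℝ}
    (hU : U = fun ω => centered P Y ω - centeredIndex P X 0 ω) {c d : ℝ} (hcd : c < d)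
    (hX : 0 < liminf (fun x : ℝ => ⨅ q ∈ Metric.sphere (0 : EuclideanSpace ℝ (Fin p)) 1,
      ENNReal.ofReal (x ^ c) * survival P (centeredIndex P X q) x) atTop)
    (htail : limsup (fun x : ℝ => ENNReal.ofReal (x ^ d) * survival P (fun ω => |U ω|) x) atTop
      < ⊤) :
    ∃ K : ℝ, 0 < K ∧ ∀ᶠ ε in 𝓝[>] (0 : ℝ),
      Metric.hausdorffEDist (identifiedSet P X Y) (regularizedSet P X Y ε)
        ≤ ENNReal.ofReal (K * ε ^ (1 / c - 1 / d)) := by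
  have hUY : U = centered P Y := by
    rw [hU, centeredIndex_zero]
    simp
  rw [hUY] at htail
  obtain ⟨r, hr0, hr⟩ := ENNReal.lt_iff_exists_nnreal_btwn.1 hX
  have hr' : 0 < (r : ℝ) := by exact_mod_cast hr0
  obtain ⟨x₁, hx₁⟩ := eventually_atTop.1 (eventually_lt_of_lt_liminf hr)
  have hA : ∀ q : EuclideanSpace ℝ (Fin p), ‖q‖ = 1 → ∀ x, max x₁ 1 ≤ x →
      ENNReal.ofReal r < ENNReal.ofReal (x ^ c) * survival P (centeredIndex P X q) x := by
    intro q hq x hx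
    rw [ENNReal.ofReal_coe_nnreal]
    exact (hx₁ x ((le_max_left _ _).trans hx)).trans_le (iInf₂_le q (by simpa using hq))
  -- Here `c` is an arbitrary real; integrability of one index forces `c ≥ 1`, hence `d > 1`.
  have hc : 1 ≤ c := one_le_of_lt_rpow_mul_survival
    (integrable_centeredIndex h.integrable_X (EuclideanSpace.single ⟨0, hp⟩ 1)) hr'
    (eventually_atTop.2 ⟨_, hA _ (by simp)⟩)
  have hc0 : 0 < c := by linarith
  obtain ⟨K, hK, hKU⟩ := exists_superquantile_le_rpow (integrable_centered h.integrable_Y)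
    (by linarith) htail
  have hx₀ : 0 < max x₁ 1 := by positivity
  have hk : 0 < (r : ℝ) ^ (1 / c) := by positivity
  refine ⟨K / r ^ (1 / c), by positivity, ?_⟩
  filter_upwards [hKU, Ioo_mem_nhdsGT (show (0 : ℝ) < 1 / 2 by norm_num),
    Ioc_mem_nhdsGT (show 0 < r / max x₁ 1 ^ c by positivity)] with ε hεU hε hεr
  refine hausdorffEDist_le_of_subset_of_forall
    (identifiedSet_subset_regularizedSet hp h hε.1 hε.2) ?_
  rintro _ ⟨q, l, hq1, hl0, hl, rfl⟩
  obtain ⟨γ, hγ⟩ := exists_isMeanCoupling_zero h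
  refine ⟨0, hγ.mem_identifiedSet h.measurable_X h.measurable_Y h.integrable_X h.integrable_Y, ?_⟩
  rw [sub_zero, norm_smul, hq1, mul_one, Real.norm_eq_abs, abs_of_nonneg hl0]
  exact (le_ratioR_of_le_regS h hε.1 hε.2 hl).trans (rpow_tail_ratio hε.1 hk hK hεU
    (rpow_le_superquantile (integrable_centeredIndex h.integrable_X q) hc0 hr' hx₀ (hA q hq1)
      hε.1 (by linarith [hε.2]) hεr.2))

end Rates

end DataCombination

end

theorem proposition6 {Ω : Type*} [MeasurableSpace Ω] (P : Measure Ω) [IsProbabilityMeasure P]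
    (p : ℕ) (hp : 1 ≤ p) (X : Ω → EuclideanSpace ℝ (Fin p)) (Y : Ω → ℝ)
    (β₀ : EuclideanSpace ℝ (Fin p)) (hmodel : DataCombination.LinearModel P X Y β₀)
    (U : Ω → ℝ)
    (hU : U = fun ω =>
      DataCombination.centered P Y ω - DataCombination.centeredIndex P X β₀ ω) :
    (∀ (c d : ℝ) (f : ℝ → ℝ≥0∞), 1 < c → c < d →
      DataCombination.IsElliptical (P.map X) →
      P.map X ≪ volume →
      Measurable f →
      P.map (DataCombination.centeredIndex P X β₀) = volume.withDensity f →
      0 < liminf (fun x : ℝ => ENNReal.ofReal (|x| ^ (1 + c)) * f x) (comap (fun x => |x|) atTop) →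
      limsup (fun x : ℝ => ENNReal.ofReal (x ^ d) *
        DataCombination.survival P (fun ω => |U ω|) x) atTop < ⊤ →
      ∃ K₁ : ℝ, 0 < K₁ ∧ ∀ᶠ ε in 𝓝[>] (0 : ℝ),
        Metric.hausdorffEDist (DataCombination.identifiedSet P X Y)
            (DataCombination.regularizedSet P X Y ε)
          ≤ ENNReal.ofReal (K₁ * ε ^ ((1 / c - 1 / d) / (1 + 1 / d)))) ∧
    (∀ c d : ℝ, c < d →
      β₀ = 0 →
      0 < liminf (fun x : ℝ => ⨅ q ∈ Metric.sphere (0 : EuclideanSpace ℝ (Fin p)) 1,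
        ENNReal.ofReal (x ^ c) *
          DataCombination.survival P (DataCombination.centeredIndex P X q) x) atTop →
      limsup (fun x : ℝ => ENNReal.ofReal (x ^ d) *
        DataCombination.survival P (fun ω => |U ω|) x) atTop < ⊤ →
      ∃ K₂ : ℝ, 0 < K₂ ∧ ∀ᶠ ε in 𝓝[>] (0 : ℝ),
        Metric.hausdorffEDist (DataCombination.identifiedSet P X Y)
            (DataCombination.regularizedSet P X Y ε)
          ≤ ENNReal.ofReal (K₂ * ε ^ (1 / c - 1 / d))) := by
  refine ⟨fun c d f hc hcd hell _ _ hdens hf htail => ?_, fun c d hcd hβ₀ hX htail => ?_⟩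
  · obtain ⟨K, hK, hev⟩ := DataCombination.hausdorffEDist_le_of_elliptical hp hmodel hU hc hcd hell
      hdens hf htail
    refine ⟨K, hK, ?_⟩
    filter_upwards [hev, Ioo_mem_nhdsGT (one_pos (α := ℝ))] with ε h1 h2
    refine h1.trans (ENNReal.ofReal_le_ofReal ?_)
    have hc0 : 0 < c := by linarith
    have hd0 : 0 < d := by linarith
    have hexp : 0 ≤ 1 / c - 1 / d := sub_nonneg.2 (one_div_le_one_div_of_le hc0 hcd.le)
    gcongr ?_ * ?_
    -- For `ε < 1`, dividing the nonnegative exponent by `1 + 1/d ≥ 1` only enlarges the bound.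
    refine Real.rpow_le_rpow_of_exponent_ge h2.1 h2.2.le (div_le_self hexp ?_)
    have : 0 < 1 / d := by positivity
    linarith
  · subst hβ₀
    exact DataCombination.hausdorffEDist_le_of_eq_zero hp hmodel hU hcd hX htail
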